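/- Let $X=\Gamma\backslash\mathbb H^2$ be a closed oriented hyperbolic surface, where $\Gamma\le \mathrm{PSL}(2,\mathbb R)$ is discrete, acts freely on $\mathbb H^2$ and has compact quotient, and let $\mathcal G$ be the space of unoriented bi-infinite geodesics of $\mathbb H^2$, identified with the set of unordered pairs of distinct points of $\partial\mathbb H^2$ with its quotient topology. Let $\mu$ be a geodesic current on $X$, that is, a $\Gamma$-invariant, locally finite positive Borel measure on $\mathcal G$. For a subset $\tau$ of a geodesic segment let $G(\tau)\subset\mathcal G$ be the set of geodesics meeting $\tau$ in exactly one point, and put $$d_\mu(x,y)=\tfrac12\bigl\{\mu(G[x,y))+\mu(G(x,y])\bigr\},\qquad x,y\in\mathbb H^2 ,$$ where $[x,y)$ and $(x,y]$ are half-open geodesic segments. This is a pseudo-distance on $\mathbb H^2$; its metric quotient (points at pseudo-distance $0$ are identified) is the dual space $X_\mu$. A metric space $(Y,d)$ is $\delta$-hyperbolic if for all $x,y,z,w\in Y$ the two largest of the three numbers $d(x,y)+d(z,w)$, $d(x,z)+d(y,w)$, $d(y,z)+d(x,w)$ differ by at most $2\delta$. A measured geodesic lamination on $X$ is a (possibly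 empty) set $\Lambda$ of pairwise disjoint simple complete geodesics of $X$ whose union is closed, together with a transverse measure: a family of locally finite Borel measures $\lambda_\alpha$, one on each regular $C^1$ arc $\alpha$ transverse to $\Lambda$ with endpoints off $\Lambda$, such that the support of $\lambda_\alpha$ is $\alpha\cap\Lambda$, such that $\lambda_{\alpha'}$ is the restriction of $\lambda_\alpha$ whenever $\alpha'\subset\alpha$ is a sub-arc, and such that the family is invariant under isotopies of transverse arcs (along which points stay in the same leaf or stay off $\Lambda$). Here arcs and leaves may be lifted to $\mathbb H^2$, and the family $\lambda$ is then $\Gamma$-equivariant. Its associated geodesic current is the one that is concentrated on the set of lifts of leaves of $\Lambda$ and gives, for every lifted transverse arc $\alpha$ meeting each lifted leaf at most once and every Borel set $S\subset\alpha$, mass $\lambda_\alpha(S)$ to the set of lifted leaves crossing $\alpha$ at a point of $S$. One says that $\mu$ is a measured lamination if it is the geodesic current associated with some measured geodesic lamination on $X$. Then $X_\mu$ is $0$-hyperbolic if and only if $\mu$ is a measured lamination. -/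

import Mathlib

open scoped UpperHalfPlane MatrixGroups unitInterval
open Set MeasureTheory

noncomputable section

/-! ### Closed hyperbolic surfaces

The universal cover is the upper half-plane `ℍ` with its hyperbolic metric, and the surface is
`X = Γ \ ℍ`.  A subgroup of `PSL(2, ℝ)` is represented by a subgroup of `SL(2, ℝ)` with that
image. -/

/-- `Γ \ ℍ` is a closed hyperbolic surface with universal covering `ℍ → Γ \ ℍ`: the group `Γ` is
discrete, its image in `PSL(2, ℝ)` acts freely on `ℍ`, and the quotient is compact. -/
structure IsClosedSurfaceGroup (Γ : Subgroup SL(2, ℝ)) : Prop where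
  discrete : DiscreteTopology Γ
  free : ∀ g ∈ Γ, ∀ z : ℍ, g • z = z → ∀ w : ℍ, g • w = w
  compact : CompactSpace (MulAction.orbitRel.Quotient Γ ℍ)

/-! ### The space of geodesics

The boundary at infinity of `ℍ` is the circle `OnePoint ℝ`. -/

/-- Ordered pairs of distinct boundary points. -/
abbrev BoundaryPair : Type := {p : OnePoint ℝ × OnePoint ℝ // p.1 ≠ p.2}

/-- The flip `(a, b) ↦ (b, a)`. -/
def BoundaryPair.flip (p : BoundaryPair) : BoundaryPair := ⟨(p.1.2, p.1.1), p.2.symm⟩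

/-- Two ordered pairs are equivalent when they agree up to order. -/
instance BoundaryPair.setoid : Setoid BoundaryPair where
  r p q := p = q ∨ p = q.flip
  iseqv :=
    { refl := fun _ => Or.inl rfl
      symm := by
        rintro p q (h | h)
        · exact Or.inl h.symm
        · subst h; exact Or.inr rfl
      trans := by
        rintro p q r (h | h) (h' | h')
        · exact Or.inl (h.trans h')
        · exact Or.inr (h.trans h')
        · subst h'; exact Or.inr h
        · subst h'; exact Or.inl h }

/-- Unoriented, unparametrized bi-infinite geodesics of `ℍ`, identified with the unordered pairs of
distinct boundary points. -/
abbrev HypGeodesic : Type := Quotient BoundaryPair.setoid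

instance HypGeodesic.measurableSpace : MeasurableSpace HypGeodesic := borel HypGeodesic

instance HypGeodesic.borelSpace : BorelSpace HypGeodesic := ⟨rfl⟩

/-- Homogeneous coordinates of a boundary point: `x` is `[x : 1]` and `∞` is `[1 : 0]`. -/
def bdryCoord (a : OnePoint ℝ) : ℝ × ℝ := a.elim (1, 0) (fun x => (x, 1))

/-- An equation of the geodesic with endpoints `a` and `b`.  For `a, b` real it is
`|z|² - (a + b) Re z + a b`, vanishing on the half-circle with diameter `[a, b]`; if one endpoint is
`∞` and the other is a real number `b` it is `b - Re z`, vanishing on the vertical line at `b`. -/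
def pairEqn (a b : OnePoint ℝ) (z : ℍ) : ℝ :=
  (bdryCoord a).2 * (bdryCoord b).2 * (z.re ^ 2 + z.im ^ 2)
    - ((bdryCoord a).1 * (bdryCoord b).2 + (bdryCoord a).2 * (bdryCoord b).1) * z.re
    + (bdryCoord a).1 * (bdryCoord b).1

lemma pairEqn_comm (a b : OnePoint ℝ) (z : ℍ) : pairEqn a b z = pairEqn b a z := by
  simp only [pairEqn]; ring

namespace HypGeodesic

/-- The defining equation of a geodesic. -/
def eqn (γ : HypGeodesic) (z : ℍ) : ℝ :=
  Quotient.lift (fun p : BoundaryPair => pairEqn p.1.1 p.1.2 z)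
    (by
      rintro p q (h | h)
      · rw [h]
      · subst h; exact pairEqn_comm _ _ _) γ

/-- The geodesic as a subset of `ℍ`. -/
def carrier (γ : HypGeodesic) : Set ℍ := {z | γ.eqn z = 0}

/-- `SL(2, ℝ)` acts on geodesics by Möbius transformations of the endpoints. -/
def act (g : SL(2, ℝ)) : HypGeodesic → HypGeodesic :=
  Quotient.map
    (fun p : BoundaryPair =>
      ⟨((g : GL (Fin 2) ℝ) • p.1.1, (g : GL (Fin 2) ℝ) • p.1.2),
        fun h => p.2 (MulAction.injective (g : GL (Fin 2) ℝ) h)⟩)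
    (by
      rintro p q (h | h)
      · subst h; exact Or.inl rfl
      · subst h; exact Or.inr rfl)

end HypGeodesic

/-! ### Geodesic currents -/

/-- A geodesic current on `Γ \ ℍ`: a `Γ`-invariant locally finite positive Borel (equivalently,
Radon) measure on the space of geodesics of `ℍ`. -/
structure GeodesicCurrent (Γ : Subgroup SL(2, ℝ)) where
  toMeasure : Measure HypGeodesic
  locallyFinite : IsLocallyFiniteMeasure toMeasure
  invariant : ∀ g ∈ Γ, ∀ A : Set HypGeodesic, MeasurableSet A →
    toMeasure (HypGeodesic.act g ⁻¹' A) = toMeasure A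

/-! ### Segments, transversals and the pseudo-distance of a current -/

/-- The closed geodesic segment `[x, y]`. -/
def hypSegment (x y : ℍ) : Set ℍ := {z | dist x z + dist z y = dist x y}

/-- The half-open geodesic segment `[x, y)` (empty if `x = y`). -/
def hypIco (x y : ℍ) : Set ℍ := hypSegment x y \ {y}

/-- The half-open geodesic segment `(x, y]` (empty if `x = y`). -/
def hypIoc (x y : ℍ) : Set ℍ := hypSegment x y \ {x}

/-- The geodesics intersecting `τ` transversely, that is, in exactly one point. -/
def transversal (τ : Set ℍ) : Set HypGeodesic := {γ | ∃ p, γ.carrier ∩ τ = {p}}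

/-- The pseudo-distance `d_μ(x, y) = (μ(G[x, y)) + μ(G(x, y])) / 2`. -/
def GeodesicCurrent.pdist {Γ : Subgroup SL(2, ℝ)} (μ : GeodesicCurrent Γ) (x y : ℍ) : ℝ :=
  (1 / 2) * ((μ.toMeasure (transversal (hypIco x y))).toReal
    + (μ.toMeasure (transversal (hypIoc x y))).toReal)

/-! ### `d_μ` is a pseudo-distance -/

lemma hypIoc_eq (x y : ℍ) : hypIoc x y = hypIco y x := by
  ext z
  simp only [hypIoc, hypIco, hypSegment, mem_sdiff, mem_ofPred_eq, mem_singleton_iff]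
  rw [dist_comm x z, dist_comm z y, dist_comm x y, add_comm]

/-- Geodesic segments are straight in the coordinates `(Re z, |z|²)`. -/
lemma mem_hypSegment_iff {x y : ℍ} (hxy : x ≠ y) (z : ℍ) :
    z ∈ hypSegment x y ↔ ∃ t : ℝ, 0 ≤ t ∧ t ≤ 1 ∧ z.re = (1 - t) * x.re + t * y.re ∧
      z.re ^ 2 + z.im ^ 2
        = (1 - t) * (x.re ^ 2 + x.im ^ 2) + t * (y.re ^ 2 + y.im ^ 2) := by
  have hx := x.im_pos
  have hy := y.im_pos
  have hz := z.im_pos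
  have hA := UpperHalfPlane.cosh_dist' x z
  have hB := UpperHalfPlane.cosh_dist' z y
  have hC := UpperHalfPlane.cosh_dist' x y
  have hne : 0 < (x.re - y.re) ^ 2 + (x.im - y.im) ^ 2 := by
    by_contra h
    apply hxy
    apply UpperHalfPlane.ext_re_im
    · nlinarith [sq_nonneg (x.re - y.re), sq_nonneg (x.im - y.im)]
    · nlinarith [sq_nonneg (x.re - y.re), sq_nonneg (x.im - y.im)]
  set a := dist x z with ha
  set b := dist z y with hb
  set c := dist x y with hc
  have ha0 : 0 ≤ a := dist_nonneg
  have hb0 : 0 ≤ b := dist_nonneg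
  have hc0 : 0 ≤ c := dist_nonneg
  have key : z ∈ hypSegment x y ↔
      0 ≤ Real.cosh c - Real.cosh a * Real.cosh b ∧
      (Real.cosh a ^ 2 - 1) * (Real.cosh b ^ 2 - 1)
        - (Real.cosh c - Real.cosh a * Real.cosh b) ^ 2 = 0 := by
    have hsa := Real.sinh_nonneg_iff.2 ha0
    have hsb := Real.sinh_nonneg_iff.2 hb0
    have h1 := Real.cosh_sq a
    have h2 := Real.cosh_sq b
    have h3 := Real.cosh_add a b
    have hsab := mul_nonneg hsa hsb
    have e : (Real.cosh a ^ 2 - 1) * (Real.cosh b ^ 2 - 1)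
        = (Real.sinh a * Real.sinh b) ^ 2 := by rw [h1, h2]; ring
    rw [e]
    constructor
    · intro h
      have h : a + b = c := h
      rw [h] at h3
      rw [h3]
      constructor
      · linarith
      · ring
    · rintro ⟨h4, h5⟩
      have h6 : Real.sinh a * Real.sinh b = Real.cosh c - Real.cosh a * Real.cosh b :=
        (sq_eq_sq₀ hsab h4).1 (by linarith)
      have h7 : Real.cosh (a + b) = Real.cosh c := by linarith
      exact Real.cosh_injOn (add_nonneg ha0 hb0 : a + b ∈ Ici 0) (hc0 : c ∈ Ici 0) h7
  rw [key, hA, hB, hC]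
  generalize x.re = x1, x.im = x2, y.re = y1, y.im = y2, z.re = z1, z.im = z2 at *
  clear key hA hB hC ha0 hb0 hc0 hxy
  clear_value a b c
  have e1 : ((((x1 - z1) ^ 2 + x2 ^ 2 + z2 ^ 2) / (2 * x2 * z2)) ^ 2 - 1)
        * ((((z1 - y1) ^ 2 + z2 ^ 2 + y2 ^ 2) / (2 * z2 * y2)) ^ 2 - 1)
        - (((x1 - y1) ^ 2 + x2 ^ 2 + y2 ^ 2) / (2 * x2 * y2)
          - ((x1 - z1) ^ 2 + x2 ^ 2 + z2 ^ 2) / (2 * x2 * z2)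
            * (((z1 - y1) ^ 2 + z2 ^ 2 + y2 ^ 2) / (2 * z2 * y2))) ^ 2
      = (((x1 ^ 2 + x2 ^ 2) - (z1 ^ 2 + z2 ^ 2)) * (y1 - z1)
          - ((y1 ^ 2 + y2 ^ 2) - (z1 ^ 2 + z2 ^ 2)) * (x1 - z1)) ^ 2
        / (2 * x2 * y2 * z2) ^ 2 := by
    field_simp
    ring
  have e2 : ((x1 - y1) ^ 2 + x2 ^ 2 + y2 ^ 2) / (2 * x2 * y2)
          - ((x1 - z1) ^ 2 + x2 ^ 2 + z2 ^ 2) / (2 * x2 * z2)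
            * (((z1 - y1) ^ 2 + z2 ^ 2 + y2 ^ 2) / (2 * z2 * y2))
      = (2 * ((x1 - y1) ^ 2 + x2 ^ 2 + y2 ^ 2) * z2 ^ 2
          - ((x1 - z1) ^ 2 + x2 ^ 2 + z2 ^ 2) * ((z1 - y1) ^ 2 + z2 ^ 2 + y2 ^ 2))
        / (4 * x2 * y2 * z2 ^ 2) := by
    field_simp
    ring
  have e3 : ∀ t : ℝ, z1 = (1 - t) * x1 + t * y1 →
      z1 ^ 2 + z2 ^ 2 = (1 - t) * (x1 ^ 2 + x2 ^ 2) + t * (y1 ^ 2 + y2 ^ 2) →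
      2 * ((x1 - y1) ^ 2 + x2 ^ 2 + y2 ^ 2) * z2 ^ 2
          - ((x1 - z1) ^ 2 + x2 ^ 2 + z2 ^ 2) * ((z1 - y1) ^ 2 + z2 ^ 2 + y2 ^ 2)
        = t * (1 - t) * (((x1 - y1) ^ 2 + (x2 - y2) ^ 2)
            * ((x1 - y1) ^ 2 + (x2 + y2) ^ 2)) := by
    intro t h1 h2
    have h3 : z2 ^ 2
        = (1 - t) * (x1 ^ 2 + x2 ^ 2) + t * (y1 ^ 2 + y2 ^ 2) - z1 ^ 2 := by linarith
    rw [h3, h1]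
    ring
  have hP : 0 < ((x1 - y1) ^ 2 + (x2 - y2) ^ 2) * ((x1 - y1) ^ 2 + (x2 + y2) ^ 2) := by
    positivity
  rw [e1, e2]
  constructor
  · rintro ⟨h1, h2⟩
    have hD : ((x1 ^ 2 + x2 ^ 2) - (z1 ^ 2 + z2 ^ 2)) * (y1 - z1)
          - ((y1 ^ 2 + y2 ^ 2) - (z1 ^ 2 + z2 ^ 2)) * (x1 - z1) = 0 := by
      rw [div_eq_zero_iff] at h2
      rcases h2 with h2 | h2
      · exact pow_eq_zero_iff (two_ne_zero) |>.1 h2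
      · exact absurd h2 (by positivity)
    obtain ⟨t, h3, h4⟩ : ∃ t : ℝ, z1 = (1 - t) * x1 + t * y1 ∧
        z1 ^ 2 + z2 ^ 2 = (1 - t) * (x1 ^ 2 + x2 ^ 2) + t * (y1 ^ 2 + y2 ^ 2) := by
      by_cases h : y1 = x1
      · subst h
        have hv : (y1 ^ 2 + y2 ^ 2) - (y1 ^ 2 + x2 ^ 2) ≠ 0 := by
          intro h
          have : (y2 - x2) * (y2 + x2) = 0 := by linarith
          rcases mul_eq_zero.1 this with h' | h'
          · have : x2 = y2 := by linarith
            subst this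
            simp at hne
          · linarith
        refine ⟨((z1 ^ 2 + z2 ^ 2) - (y1 ^ 2 + x2 ^ 2))
          / ((y1 ^ 2 + y2 ^ 2) - (y1 ^ 2 + x2 ^ 2)), ?_, ?_⟩
        · have : ((y1 ^ 2 + y2 ^ 2) - (y1 ^ 2 + x2 ^ 2)) * (z1 - y1) = 0 := by linarith
          have := (mul_eq_zero.1 this).resolve_left hv
          linarith
        · field_simp
          ring
      · have hv : y1 - x1 ≠ 0 := sub_ne_zero.2 h
        refine ⟨(z1 - x1) / (y1 - x1), ?_, ?_⟩
        · field_simp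
          ring
        · field_simp
          linear_combination -hD
    refine ⟨t, ?_⟩
    rw [e3 t h3 h4] at h1
    have h5 : 0 ≤ t * (1 - t) := by
      by_contra h
      have : t * (1 - t) * (((x1 - y1) ^ 2 + (x2 - y2) ^ 2)
            * ((x1 - y1) ^ 2 + (x2 + y2) ^ 2)) / (4 * x2 * y2 * z2 ^ 2) < 0 :=
        div_neg_of_neg_of_pos (mul_neg_of_neg_of_pos (not_le.1 h) hP) (by positivity)
      linarith
    have h6 := sq_nonneg t
    have h7 := sq_nonneg (1 - t)
    exact ⟨by linarith, by linarith, h3, h4⟩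
  · rintro ⟨t, ht0, ht1, h3, h4⟩
    constructor
    · rw [e3 t h3 h4]
      have : 0 ≤ 1 - t := by linarith
      positivity
    · have : ((x1 ^ 2 + x2 ^ 2) - (z1 ^ 2 + z2 ^ 2)) * (y1 - z1)
          - ((y1 ^ 2 + y2 ^ 2) - (z1 ^ 2 + z2 ^ 2)) * (x1 - z1) = 0 := by
        rw [h4, h3]; ring
      rw [this]; simp

/-- A geodesic, having an equation affine in `(Re z, |z|²)`, meets `[x, y)` in exactly one point iff
it passes through `x` but not `y`, or strictly separates `x` and `y`. -/
lemma mem_transversal_hypIco {x y : ℍ} (γ : HypGeodesic) :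
    γ ∈ transversal (hypIco x y) ↔
      (γ.eqn x = 0 ∧ γ.eqn y ≠ 0) ∨ γ.eqn x * γ.eqn y < 0 := by
  by_cases hxy : x = y
  · subst hxy
    have : hypIco x x = ∅ := by
      ext z
      simp only [hypIco, hypSegment, mem_sdiff, mem_ofPred_eq, mem_singleton_iff, dist_self,
        mem_empty_iff_false, iff_false, not_and, not_not]
      intro h
      have h1 : 0 ≤ dist x z := dist_nonneg
      have h2 : 0 ≤ dist z x := dist_nonneg
      exact dist_le_zero.1 (by linarith)
    constructor
    · rintro ⟨p, hp⟩
      rw [this, inter_empty] at hp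
      exact absurd hp.symm (singleton_ne_empty p)
    · rintro (⟨h, h'⟩ | h)
      · exact absurd h h'
      · exact absurd h (not_lt.2 (mul_self_nonneg _))
  -- the equation along the segment
  obtain ⟨α, β, δ, hγ⟩ : ∃ α β δ : ℝ, ∀ z, γ.eqn z = α * (z.re ^ 2 + z.im ^ 2) + β * z.re + δ := by
    induction γ using Quotient.inductionOn with | _ p
    refine ⟨(bdryCoord p.1.1).2 * (bdryCoord p.1.2).2,
      -((bdryCoord p.1.1).1 * (bdryCoord p.1.2).2 + (bdryCoord p.1.1).2 * (bdryCoord p.1.2).1),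
      (bdryCoord p.1.1).1 * (bdryCoord p.1.2).1, fun z => ?_⟩
    show pairEqn _ _ z = _
    rw [pairEqn]; ring
  have hline : ∀ (t : ℝ) (z : ℍ), z.re = (1 - t) * x.re + t * y.re →
      z.re ^ 2 + z.im ^ 2 = (1 - t) * (x.re ^ 2 + x.im ^ 2) + t * (y.re ^ 2 + y.im ^ 2) →
      γ.eqn z = (1 - t) * γ.eqn x + t * γ.eqn y := by
    intro t z h1 h2
    rw [hγ z, hγ x, hγ y, h2, h1]; ring
  have hpt : ∀ t : ℝ, 0 ≤ t → t ≤ 1 → ∃ z : ℍ, z.re = (1 - t) * x.re + t * y.re ∧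
      z.re ^ 2 + z.im ^ 2 = (1 - t) * (x.re ^ 2 + x.im ^ 2) + t * (y.re ^ 2 + y.im ^ 2) := by
    intro t h0 h1
    have hpos : 0 < (1 - t) * x.im ^ 2 + t * y.im ^ 2 + t * (1 - t) * (x.re - y.re) ^ 2 := by
      have hx := pow_pos x.im_pos 2
      have hy := pow_pos y.im_pos 2
      have h3 : 0 ≤ t * (1 - t) * (x.re - y.re) ^ 2 :=
        mul_nonneg (mul_nonneg h0 (by linarith)) (sq_nonneg _)
      rcases h0.eq_or_lt with h | h
      · subst h; simpa using hx
      · have := mul_pos h hy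
        have := mul_nonneg (sub_nonneg.2 h1) hx.le
        linarith
    refine ⟨⟨⟨(1 - t) * x.re + t * y.re, Real.sqrt _⟩, Real.sqrt_pos.2 hpos⟩, rfl, ?_⟩
    show ((1 - t) * x.re + t * y.re) ^ 2 + Real.sqrt _ ^ 2 = _
    rw [Real.sq_sqrt hpos.le]; ring
  have hend : ∀ (t : ℝ) (z : ℍ), z.re = (1 - t) * x.re + t * y.re →
      z.re ^ 2 + z.im ^ 2 = (1 - t) * (x.re ^ 2 + x.im ^ 2) + t * (y.re ^ 2 + y.im ^ 2) →
      (z = y ↔ t = 1) := by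
    have hc : ∀ z w : ℍ, z.re = w.re → z.re ^ 2 + z.im ^ 2 = w.re ^ 2 + w.im ^ 2 → z = w := by
      intro z w h1 h2
      refine UpperHalfPlane.ext_re_im h1 ?_
      rw [h1] at h2
      exact (sq_eq_sq₀ z.im_pos.le w.im_pos.le).1 (by linarith)
    intro t z h1 h2
    constructor
    · intro h
      subst h
      by_contra ht
      have ht' : 1 - t ≠ 0 := sub_ne_zero.2 (Ne.symm ht)
      refine hxy (hc x z ?_ ?_)
      · exact mul_left_cancel₀ ht' (by linarith)
      · exact mul_left_cancel₀ ht' (by linarith)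
    · intro h
      subst h
      exact hc z y (by linarith) (by linarith)
  have hmem : ∀ z, z ∈ hypIco x y ↔ ∃ t : ℝ, 0 ≤ t ∧ t < 1 ∧ z.re = (1 - t) * x.re + t * y.re ∧
      z.re ^ 2 + z.im ^ 2
        = (1 - t) * (x.re ^ 2 + x.im ^ 2) + t * (y.re ^ 2 + y.im ^ 2) := by
    intro z
    rw [hypIco, mem_sdiff, mem_hypSegment_iff hxy, mem_singleton_iff]
    constructor
    · rintro ⟨⟨t, h0, h1, h2, h3⟩, h4⟩
      exact ⟨t, h0, lt_of_le_of_ne h1 (fun h => h4 ((hend t z h2 h3).2 h)), h2, h3⟩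
    · rintro ⟨t, h0, h1, h2, h3⟩
      exact ⟨⟨t, h0, h1.le, h2, h3⟩, fun h => h1.ne ((hend t z h2 h3).1 h)⟩
  constructor
  · rintro ⟨p, hp⟩
    have hp' : p ∈ γ.carrier ∩ hypIco x y := by rw [hp]; rfl
    obtain ⟨hpγ, hpI⟩ := hp'
    obtain ⟨t, h0, h1, h2, h3⟩ := (hmem p).1 hpI
    have h4 : (1 - t) * γ.eqn x + t * γ.eqn y = 0 := by
      rw [← hline t p h2 h3]; exact hpγ
    by_cases hex : γ.eqn x = 0
    · left
      refine ⟨hex, fun hey => ?_⟩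
      have hall : ∀ s : ℝ, 0 ≤ s → s < 1 → ∃ z : ℍ, z.re = (1 - s) * x.re + s * y.re ∧
          z.re ^ 2 + z.im ^ 2
            = (1 - s) * (x.re ^ 2 + x.im ^ 2) + s * (y.re ^ 2 + y.im ^ 2) ∧ z = p := by
        intro s hs0 hs1
        obtain ⟨z, hz1, hz2⟩ := hpt s hs0 hs1.le
        refine ⟨z, hz1, hz2, ?_⟩
        have : z ∈ γ.carrier ∩ hypIco x y := by
          refine ⟨?_, (hmem z).2 ⟨s, hs0, hs1, hz1, hz2⟩⟩
          show γ.eqn z = 0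
          rw [hline s z hz1 hz2, hex, hey]; ring
        rw [hp] at this
        exact this
      obtain ⟨z, hz1, hz2, rfl⟩ := hall 0 le_rfl one_pos
      obtain ⟨w, hw1, hw2, rfl⟩ := hall (1 / 2) (by norm_num) (by norm_num)
      refine hxy (UpperHalfPlane.ext_re_im (by linarith) ?_)
      exact (sq_eq_sq₀ x.im_pos.le y.im_pos.le).1 (by
        have : x.re = y.re := by linarith
        rw [this] at hz2 hw2
        linarith)
    · right
      have ht : 0 < t := lt_of_le_of_ne h0 (by
        rintro rfl
        apply hex
        linarith)
      have hs : 0 < 1 - t := by linarith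
      have h5 : t * (γ.eqn x * γ.eqn y) = -((1 - t) * γ.eqn x ^ 2) := by
        linear_combination γ.eqn x * h4
      have h6 : 0 < (1 - t) * γ.eqn x ^ 2 := by positivity
      by_contra h
      have := mul_nonneg ht.le (not_lt.1 h)
      linarith
  · intro h
    have hd : γ.eqn x - γ.eqn y ≠ 0 := by
      rcases h with ⟨h, h'⟩ | h
      · rw [h]; simpa using h'
      · intro h0
        rw [sub_eq_zero.1 h0] at h
        exact absurd h (not_lt.2 (mul_self_nonneg _))
    obtain ⟨t, h0, h1, ht⟩ : ∃ t : ℝ, 0 ≤ t ∧ t < 1 ∧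
        t * (γ.eqn x - γ.eqn y) = γ.eqn x := by
      rcases h with ⟨h, h'⟩ | h
      · exact ⟨0, le_rfl, one_pos, by rw [h]; ring⟩
      · refine ⟨γ.eqn x / (γ.eqn x - γ.eqn y), ?_, ?_, div_mul_cancel₀ _ hd⟩
        · rcases lt_or_gt_of_ne hd with h' | h'
          · exact div_nonneg_of_nonpos (by nlinarith) h'.le
          · exact div_nonneg (by nlinarith) h'.le
        · rcases lt_or_gt_of_ne hd with h' | h'
          · rw [div_lt_one_of_neg h']; nlinarith
          · rw [div_lt_one h']; nlinarith
    obtain ⟨p, hp1, hp2⟩ := hpt t h0 h1.le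
    refine ⟨p, ?_⟩
    ext z
    rw [mem_singleton_iff]
    constructor
    · rintro ⟨hz, hzI⟩
      obtain ⟨s, hs0, hs1, hs2, hs3⟩ := (hmem z).1 hzI
      have h5 : (1 - s) * γ.eqn x + s * γ.eqn y = 0 := by
        rw [← hline s z hs2 hs3]; exact hz
      have : s = t := mul_right_cancel₀ hd (by linarith)
      subst this
      refine UpperHalfPlane.ext_re_im (by rw [hs2, hp1]) ?_
      refine (sq_eq_sq₀ z.im_pos.le p.im_pos.le).1 ?_
      have : z.re = p.re := by rw [hs2, hp1]
      rw [this] at hs3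
      linarith
    · rintro rfl
      refine ⟨?_, (hmem z).2 ⟨t, h0, h1, hp1, hp2⟩⟩
      show γ.eqn z = 0
      rw [hline t z hp1 hp2]
      linarith

/-! Scale-invariant versions of the equations, continuous in the endpoints. -/

/-- Homogeneous coordinates normalized to have length one. -/
def bdryNorm (a : OnePoint ℝ) : ℝ := (bdryCoord a).1 ^ 2 + (bdryCoord a).2 ^ 2

lemma bdryNorm_pos (a : OnePoint ℝ) : 0 < bdryNorm a := by
  induction a using OnePoint.rec with
  | infty => simp [bdryNorm, bdryCoord]
  | coe x => simp only [bdryNorm, bdryCoord, OnePoint.elim_some]; positivity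

lemma continuous_bdry_aux (f : ℝ → ℝ) (hf : Continuous f) (c : ℝ)
    (hc : Filter.Tendsto f (Filter.cocompact ℝ) (nhds c)) :
    Continuous (fun a : OnePoint ℝ => a.elim c f) := by
  rw [OnePoint.continuous_iff, Filter.coclosedCompact_eq_cocompact]
  exact ⟨hc, hf⟩

lemma tendsto_inv_one_add_sq :
    Filter.Tendsto (fun x : ℝ => (x ^ 2 + 1)⁻¹) (Filter.cocompact ℝ) (nhds 0) := by
  refine tendsto_inv_atTop_zero.comp (Filter.tendsto_atTop_add_const_right _ _ ?_)
  have := (Filter.tendsto_pow_atTop (α := ℝ) two_ne_zero).comp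
    (tendsto_norm_cocompact_atTop (E := ℝ))
  refine this.congr fun x => ?_
  simp

lemma continuous_bdry₂₂ :
    Continuous (fun a : OnePoint ℝ => (bdryCoord a).2 ^ 2 / bdryNorm a) := by
  refine (continuous_bdry_aux (fun x => (x ^ 2 + 1)⁻¹) ?_ 0 tendsto_inv_one_add_sq).congr ?_
  · exact Continuous.inv₀ (by fun_prop) (fun x => by positivity)
  · intro a
    induction a using OnePoint.rec with
    | infty => simp [bdryNorm, bdryCoord]
    | coe x => simp [bdryNorm, bdryCoord]

lemma continuous_bdry₁₁ :
    Continuous (fun a : OnePoint ℝ => (bdryCoord a).1 ^ 2 / bdryNorm a) := by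
  refine (continuous_const.sub continuous_bdry₂₂ :
    Continuous fun a => (1 : ℝ) - (bdryCoord a).2 ^ 2 / bdryNorm a).congr fun a => ?_
  have := (bdryNorm_pos a).ne'
  show 1 - (bdryCoord a).2 ^ 2 / bdryNorm a = _
  rw [eq_div_iff this, sub_mul, div_mul_cancel₀ _ this, bdryNorm]
  ring

lemma continuous_bdry₁₂ :
    Continuous (fun a : OnePoint ℝ => (bdryCoord a).1 * (bdryCoord a).2 / bdryNorm a) := by
  refine (continuous_bdry_aux (fun x => x * (x ^ 2 + 1)⁻¹) ?_ 0 ?_).congr ?_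
  · exact continuous_id.mul (Continuous.inv₀ (by fun_prop) (fun x => by positivity))
  · have h := (Real.continuous_sqrt.tendsto 0).comp tendsto_inv_one_add_sq
    rw [Real.sqrt_zero] at h
    refine squeeze_zero_norm (fun x => ?_) h
    rw [Function.comp, Real.norm_eq_abs]
    apply Real.abs_le_sqrt
    have h0 : 0 < x ^ 2 + 1 := by positivity
    rw [mul_pow, inv_pow, ← div_eq_mul_inv, div_le_iff₀ (by positivity), sq (x ^ 2 + 1),
      inv_mul_cancel_left₀ h0.ne']
    linarith
  · intro a
    induction a using OnePoint.rec with
    | infty => simp [bdryNorm, bdryCoord]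
    | coe x => simp [bdryNorm, bdryCoord, div_eq_mul_inv]

/-- The product of the equation at `x` and at `y`, up to a positive factor. -/
def prodEqn (x y : ℍ) (p : OnePoint ℝ × OnePoint ℝ) : ℝ :=
  (pairEqn p.1 p.2 x * pairEqn p.1 p.2 y) / (bdryNorm p.1 * bdryNorm p.2)

lemma continuous_prodEqn (x y : ℍ) : Continuous (prodEqn x y) := by
  have h1 := continuous_bdry₁₁
  have h2 := continuous_bdry₁₂
  have h3 := continuous_bdry₂₂
  have key : prodEqn x y = fun p =>
      let P := fun a : OnePoint ℝ => (bdryCoord a).1 ^ 2 / bdryNorm a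
      let Q := fun a : OnePoint ℝ => (bdryCoord a).1 * (bdryCoord a).2 / bdryNorm a
      let R := fun a : OnePoint ℝ => (bdryCoord a).2 ^ 2 / bdryNorm a
      let X := x.re ^ 2 + x.im ^ 2
      let Y := y.re ^ 2 + y.im ^ 2
      R p.1 * R p.2 * (X * Y)
        - (Q p.1 * R p.2 + R p.1 * Q p.2) * (X * y.re + Y * x.re)
        + Q p.1 * Q p.2 * (X + Y)
        + (P p.1 * R p.2 + 2 * (Q p.1 * Q p.2) + R p.1 * P p.2) * (x.re * y.re)
        - (P p.1 * Q p.2 + Q p.1 * P p.2) * (x.re + y.re)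
        + P p.1 * P p.2 := by
    funext p
    have hp := (bdryNorm_pos p.1).ne'
    have hq := (bdryNorm_pos p.2).ne'
    simp only [prodEqn, pairEqn]
    generalize (bdryCoord p.1).1 = a1, (bdryCoord p.1).2 = a2,
      (bdryCoord p.2).1 = b1, (bdryCoord p.2).2 = b2
    field_simp
    ring
  rw [key]
  have h1' := h1.comp (continuous_fst (X := OnePoint ℝ) (Y := OnePoint ℝ))
  have h2' := h2.comp (continuous_fst (X := OnePoint ℝ) (Y := OnePoint ℝ))
  have h3' := h3.comp (continuous_fst (X := OnePoint ℝ) (Y := OnePoint ℝ))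
  have h1'' := h1.comp (continuous_snd (X := OnePoint ℝ) (Y := OnePoint ℝ))
  have h2'' := h2.comp (continuous_snd (X := OnePoint ℝ) (Y := OnePoint ℝ))
  have h3'' := h3.comp (continuous_snd (X := OnePoint ℝ) (Y := OnePoint ℝ))
  simp only [Function.comp_def] at *
  fun_prop

lemma prodEqn_neg_iff (x y : ℍ) (p : OnePoint ℝ × OnePoint ℝ) :
    prodEqn x y p < 0 ↔ pairEqn p.1 p.2 x * pairEqn p.1 p.2 y < 0 := by
  have h := mul_pos (bdryNorm_pos p.1) (bdryNorm_pos p.2)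
  rw [prodEqn, div_lt_iff₀ h, zero_mul]

lemma prodEqn_eq_zero_iff (x y : ℍ) (p : OnePoint ℝ × OnePoint ℝ) :
    prodEqn x y p = 0 ↔ pairEqn p.1 p.2 x * pairEqn p.1 p.2 y = 0 := by
  have h := mul_pos (bdryNorm_pos p.1) (bdryNorm_pos p.2)
  rw [prodEqn, div_eq_zero_iff, or_iff_left h.ne']

namespace HypGeodesic

lemma isClosed_eqn_eq_zero (x : ℍ) : IsClosed {γ : HypGeodesic | γ.eqn x = 0} := by
  rw [← isQuotientMap_quotient_mk'.isClosed_preimage]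
  have : IsClosed {p : BoundaryPair | prodEqn x x p.1 = 0} :=
    isClosed_eq ((continuous_prodEqn x x).comp continuous_subtype_val) continuous_const
  convert this using 1
  ext p
  show pairEqn _ _ x = 0 ↔ prodEqn x x p.1 = 0
  rw [prodEqn_eq_zero_iff, mul_self_eq_zero]

lemma isOpen_eqn_mul_neg (x y : ℍ) : IsOpen {γ : HypGeodesic | γ.eqn x * γ.eqn y < 0} := by
  rw [← isQuotientMap_quotient_mk'.isOpen_preimage]
  have : IsOpen {p : BoundaryPair | prodEqn x y p.1 < 0} :=
    isOpen_lt ((continuous_prodEqn x y).comp continuous_subtype_val) continuous_const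
  convert this using 1
  ext p
  show pairEqn _ _ x * pairEqn _ _ y < 0 ↔ prodEqn x y p.1 < 0
  rw [prodEqn_neg_iff]

/-- The geodesics meeting a given segment form a compact set. -/
lemma isCompact_eqn_mul_nonpos (x y : ℍ) :
    IsCompact {γ : HypGeodesic | γ.eqn x * γ.eqn y ≤ 0} := by
  have hcl : IsClosed {p : OnePoint ℝ × OnePoint ℝ | prodEqn x y p ≤ 0} :=
    isClosed_le (continuous_prodEqn x y) continuous_const
  have hK : IsCompact {p : BoundaryPair | prodEqn x y p.1 ≤ 0} := by
    rw [Topology.IsEmbedding.subtypeVal.isCompact_iff]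
    convert hcl.isCompact using 1
    ext p
    constructor
    · rintro ⟨q, hq, rfl⟩
      exact hq
    · intro hp
      refine ⟨⟨p, fun h => ?_⟩, hp, rfl⟩
      obtain ⟨a, b⟩ := p
      have h : a = b := h
      subst h
      have hpos : ∀ z : ℍ, 0 < pairEqn a a z := by
        intro z
        have hz := pow_pos z.im_pos 2
        induction a using OnePoint.rec with
        | infty => simp [pairEqn, bdryCoord]
        | coe t =>
          simp only [pairEqn, bdryCoord, OnePoint.elim_some]
          have := sq_nonneg (z.re - t)
          linarith
      have := div_pos (mul_pos (hpos x) (hpos y)) (mul_pos (bdryNorm_pos a) (bdryNorm_pos a))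
      exact absurd hp (not_le.2 this)
  convert hK.image (continuous_quotient_mk' (s := BoundaryPair.setoid)) using 1
  ext γ
  have hiff : ∀ p : BoundaryPair, prodEqn x y p.1 ≤ 0 ↔
      eqn (Quotient.mk' p) x * eqn (Quotient.mk' p) y ≤ 0 := by
    intro p
    show _ ↔ pairEqn _ _ x * pairEqn _ _ y ≤ 0
    rw [prodEqn, div_le_iff₀ (mul_pos (bdryNorm_pos _) (bdryNorm_pos _)), zero_mul]
  constructor
  · intro h
    induction γ using Quotient.inductionOn with | _ p
    exact ⟨p, (hiff p).2 h, rfl⟩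
  · rintro ⟨p, hp, rfl⟩
    exact (hiff p).1 hp

end HypGeodesic

lemma transversal_hypIco (x y : ℍ) : transversal (hypIco x y)
    = ({γ | γ.eqn x = 0} \ {γ | γ.eqn y = 0}) ∪ {γ | γ.eqn x * γ.eqn y < 0} := by
  ext γ
  exact mem_transversal_hypIco γ

lemma measurableSet_transversal_hypIco (x y : ℍ) :
    MeasurableSet (transversal (hypIco x y)) := by
  rw [transversal_hypIco]
  exact ((HypGeodesic.isClosed_eqn_eq_zero x).measurableSet.diff
    (HypGeodesic.isClosed_eqn_eq_zero y).measurableSet).union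
    (HypGeodesic.isOpen_eqn_mul_neg x y).measurableSet

namespace GeodesicCurrent

variable {Γ : Subgroup SL(2, ℝ)} (μ : GeodesicCurrent Γ)

lemma measure_transversal_lt_top (x y : ℍ) :
    μ.toMeasure (transversal (hypIco x y)) < ⊤ := by
  have := μ.locallyFinite
  refine lt_of_le_of_lt (measure_mono ?_) (HypGeodesic.isCompact_eqn_mul_nonpos x y).measure_lt_top
  intro γ hγ
  rcases (mem_transversal_hypIco γ).1 hγ with ⟨h, -⟩ | h
  · show γ.eqn x * γ.eqn y ≤ 0
    rw [h, zero_mul]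
  · exact le_of_lt h

lemma pdist_eq (x y : ℍ) : μ.pdist x y = (1 / 2) * (μ.toMeasure (transversal (hypIco x y))
    + μ.toMeasure (transversal (hypIco y x))).toReal := by
  rw [pdist, hypIoc_eq, ENNReal.toReal_add (μ.measure_transversal_lt_top x y).ne
    (μ.measure_transversal_lt_top y x).ne]

lemma pdist_self (x : ℍ) : μ.pdist x x = 0 := by
  have : transversal (hypIco x x) = ∅ := by
    ext γ
    rw [mem_transversal_hypIco]
    simp only [mem_empty_iff_false, iff_false, not_or, not_and, not_not, not_lt, imp_self,
      true_and]
    exact mul_self_nonneg _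
  rw [pdist_eq, this]
  simp

lemma pdist_comm (x y : ℍ) : μ.pdist x y = μ.pdist y x := by
  rw [pdist_eq, pdist_eq, add_comm]

lemma pdist_triangle (x y z : ℍ) : μ.pdist x z ≤ μ.pdist x y + μ.pdist y z := by
  have hfin := μ.measure_transversal_lt_top
  have hm := measurableSet_transversal_hypIco
  have hint : ∀ a b : ℍ, μ.toMeasure (transversal (hypIco a b))
      + μ.toMeasure (transversal (hypIco b a)) = ∫⁻ γ, (transversal (hypIco a b)).indicator 1 γ
        + (transversal (hypIco b a)).indicator 1 γ ∂μ.toMeasure := by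
    intro a b
    rw [lintegral_add_left (measurable_one.indicator (hm a b)), lintegral_indicator_one (hm a b),
      lintegral_indicator_one (hm b a)]
  have hle : μ.toMeasure (transversal (hypIco x z)) + μ.toMeasure (transversal (hypIco z x))
      ≤ (μ.toMeasure (transversal (hypIco x y)) + μ.toMeasure (transversal (hypIco y x)))
        + (μ.toMeasure (transversal (hypIco y z)) + μ.toMeasure (transversal (hypIco z y))) := by
    rw [hint, hint, hint, ← lintegral_add_left
      (f := fun γ => (transversal (hypIco x y)).indicator 1 γ
        + (transversal (hypIco y x)).indicator 1 γ) (Measurable.add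
      (measurable_one.indicator (hm x y)) (measurable_one.indicator (hm y x)))]
    refine lintegral_mono fun γ => ?_
    have hv : ∀ a b : ℍ, (transversal (hypIco a b)).indicator (1 : HypGeodesic → ENNReal) γ
        = if (γ.eqn a = 0 ∧ γ.eqn b ≠ 0) ∨ γ.eqn a * γ.eqn b < 0 then 1 else 0 := by
      intro a b
      by_cases h : γ ∈ transversal (hypIco a b)
      · rw [indicator_of_mem h, if_pos ((mem_transversal_hypIco γ).1 h), Pi.one_apply]
      · rw [indicator_of_notMem h, if_neg (fun h' => h ((mem_transversal_hypIco γ).2 h'))]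
    have htri : ∀ a : ℝ, (a < 0 ∧ ¬ 0 < a ∧ a ≠ 0) ∨ (¬ a < 0 ∧ ¬ 0 < a ∧ a = 0) ∨
        (¬ a < 0 ∧ 0 < a ∧ a ≠ 0) := by
      intro a
      rcases lt_trichotomy a 0 with h | h | h
      · exact Or.inl ⟨h, h.not_gt, h.ne⟩
      · subst h; simp
      · exact Or.inr (Or.inr ⟨h.not_gt, h, h.ne'⟩)
    simp only [hv]
    generalize γ.eqn x = a, γ.eqn y = b, γ.eqn z = c
    rcases htri a with ⟨ha, ha', ha''⟩ | ⟨ha, ha', ha''⟩ | ⟨ha, ha', ha''⟩ <;>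
      rcases htri b with ⟨hb, hb', hb''⟩ | ⟨hb, hb', hb''⟩ | ⟨hb, hb', hb''⟩ <;>
      rcases htri c with ⟨hc, hc', hc''⟩ | ⟨hc, hc', hc''⟩ | ⟨hc, hc', hc''⟩ <;>
      simp only [mul_neg_iff, ha, ha', ha'', hb, hb', hb'', hc, hc', hc''] <;>
      norm_num [ha'', hb'', hc'']
  rw [pdist_eq, pdist_eq, pdist_eq, ← mul_add, ← ENNReal.toReal_add
    (ENNReal.add_lt_top.2 ⟨hfin x y, hfin y x⟩).ne (ENNReal.add_lt_top.2 ⟨hfin y z, hfin z y⟩).ne]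
  refine mul_le_mul_of_nonneg_left (ENNReal.toReal_mono ?_ hle) (by norm_num)
  exact (ENNReal.add_lt_top.2 ⟨ENNReal.add_lt_top.2 ⟨hfin x y, hfin y x⟩,
    ENNReal.add_lt_top.2 ⟨hfin y z, hfin z y⟩⟩).ne

end GeodesicCurrent

/-! ### The dual space -/

/-- The universal cover `ℍ`, equipped with the pseudo-distance `d_μ`. -/
def DualCover {Γ : Subgroup SL(2, ℝ)} (_μ : GeodesicCurrent Γ) : Type := ℍ

instance DualCover.pseudoMetricSpace {Γ : Subgroup SL(2, ℝ)} (μ : GeodesicCurrent Γ) :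
    PseudoMetricSpace (DualCover μ) where
  dist := μ.pdist
  dist_self := μ.pdist_self
  dist_comm := μ.pdist_comm
  dist_triangle := μ.pdist_triangle

/-- The dual space `X_μ`: the metric quotient of `ℍ` under `d_μ`.  (`SeparationQuotient` identifies
the points at pseudo-distance zero and carries the induced distance.) -/
abbrev DualSpace {Γ : Subgroup SL(2, ℝ)} (μ : GeodesicCurrent Γ) : Type :=
  SeparationQuotient (DualCover μ)

/-- Gromov's four-point condition: among the three sums
`d(x, y) + d(z, w)`, `d(x, z) + d(y, w)`, `d(y, z) + d(x, w)` the two largest differ by at most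
`2δ`, that is, none of the three exceeds the larger of the other two by more than `2δ`. -/
def IsDeltaHyperbolic (δ : ℝ) (Y : Type*) [MetricSpace Y] : Prop :=
  ∀ x y z w : Y,
    dist x y + dist z w ≤ max (dist x z + dist y w) (dist y z + dist x w) + 2 * δ ∧
    dist x z + dist y w ≤ max (dist x y + dist z w) (dist y z + dist x w) + 2 * δ ∧
    dist y z + dist x w ≤ max (dist x y + dist z w) (dist x z + dist y w) + 2 * δ

/-! ### Measured laminations -/

/-- A geodesic lamination of `Γ \ ℍ`, given by its full preimage in `ℍ`: a `Γ`-invariant set of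
pairwise disjoint geodesics whose union is closed.  (The geodesics of `Γ \ ℍ` covered by the leaves
are simple and pairwise disjoint precisely because distinct leaves are disjoint, and their union is
closed in `Γ \ ℍ` iff its preimage is closed.)  It may be empty. -/
structure GeodesicLamination (Γ : Subgroup SL(2, ℝ)) where
  leaves : Set HypGeodesic
  invariant : ∀ g ∈ Γ, ∀ γ ∈ leaves, γ.act g ∈ leaves
  disjoint : ∀ γ ∈ leaves, ∀ γ' ∈ leaves, γ ≠ γ' → Disjoint γ.carrier γ'.carrier
  closed : IsClosed (⋃ γ ∈ leaves, γ.carrier)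

namespace GeodesicLamination

variable {Γ : Subgroup SL(2, ℝ)}

/-- The union of the leaves. -/
def union (Λ : GeodesicLamination Γ) : Set ℍ := ⋃ γ ∈ Λ.leaves, γ.carrier

/-- An arc in `ℍ` transverse to the lamination: a regular injective `C¹` path on `[0, 1]` with
endpoints off the lamination which, wherever it meets a leaf, is not tangent to it.  (Since the
differential of `γ.eqn` does not vanish along `γ`, non-tangency says that the derivative of `γ.eqn`
along the path is non-zero.)  Values of the path outside `[0, 1]` are irrelevant. -/
structure TransverseArc (Λ : GeodesicLamination Γ) where
  path : ℝ → ℍ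
  contDiff : ContDiffOn ℝ 1 (fun t => (path t : ℂ)) I
  regular : ∀ t ∈ I, derivWithin (fun s => (path s : ℂ)) I t ≠ 0
  injOn : InjOn path I
  transverse : ∀ t ∈ I, ∀ γ ∈ Λ.leaves, path t ∈ γ.carrier →
    derivWithin (fun s => γ.eqn (path s)) I t ≠ 0
  source_notMem : path 0 ∉ Λ.union
  target_notMem : path 1 ∉ Λ.union

/-- The arc as a subset of `ℍ`. -/
def TransverseArc.image {Λ : GeodesicLamination Γ} (α : Λ.TransverseArc) : Set ℍ := α.path '' I

/-- An isotopy of transverse arcs from `A 0` to `A 1`: a continuous family of transverse arcs, along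
which each point of the arc stays in the same leaf, or stays off the lamination. -/
def IsTransverseIsotopy (Λ : GeodesicLamination Γ) (A : ℝ → Λ.TransverseArc) : Prop :=
  ContinuousOn (fun p : ℝ × ℝ => (A p.1).path p.2) (I ×ˢ I) ∧
  ∀ s ∈ I, ∀ t ∈ I, ∀ γ ∈ Λ.leaves, (A s).path t ∈ γ.carrier ↔ (A 0).path t ∈ γ.carrier

/-- A transverse measure for the lamination: a family of locally finite Borel measures `λ_α`, one on
each transverse arc `α` (viewed as measures on `ℍ`), with support `α ∩ Λ`, compatible with the
restriction to sub-arcs, and invariant under isotopies of transverse arcs.  As arcs are lifted from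
`Γ \ ℍ` to `ℍ`, the family is equivariant under `Γ`. -/
structure TransverseMeasure (Λ : GeodesicLamination Γ) where
  measure : Λ.TransverseArc → Measure ℍ
  locallyFinite : ∀ α, IsLocallyFiniteMeasure (measure α)
  support_eq : ∀ α, (measure α).support = α.image ∩ Λ.union
  restrict_eq : ∀ α β : Λ.TransverseArc, β.image ⊆ α.image →
    measure β = (measure α).restrict β.image
  isotopy_eq : ∀ A : ℝ → Λ.TransverseArc, Λ.IsTransverseIsotopy A →
    ∀ T ⊆ I, MeasurableSet T → measure (A 1) ((A 1).path '' T) = measure (A 0) ((A 0).path '' T)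
  equivariant : ∀ g ∈ Γ, ∀ α β : Λ.TransverseArc, (∀ t ∈ I, β.path t = g • α.path t) →
    ∀ S : Set ℍ, MeasurableSet S → measure α ((fun z => g • z) ⁻¹' S) = measure β S

end GeodesicLamination

namespace GeodesicCurrent

variable {Γ : Subgroup SL(2, ℝ)}

/-- `μ` is the current of the measured lamination `(Λ, m)`: it is concentrated on the leaves of `Λ`,
and for each transverse arc meeting every leaf at most once, the measure of a Borel part of the arc
is the `μ`-measure of the set of leaves crossing the arc there. -/
def IsCurrentOf (μ : GeodesicCurrent Γ) (Λ : GeodesicLamination Γ) (m : Λ.TransverseMeasure) :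
    Prop :=
  μ.toMeasure Λ.leavesᶜ = 0 ∧
  ∀ α : Λ.TransverseArc, (∀ γ ∈ Λ.leaves, (γ.carrier ∩ α.image).Subsingleton) →
    ∀ S : Set ℍ, MeasurableSet S →
      m.measure α S = μ.toMeasure {γ ∈ Λ.leaves | (γ.carrier ∩ α.image ∩ S).Nonempty}

/-- `μ` is a measured lamination: it lies in the image of the embedding of the measured geodesic
laminations into the geodesic currents. -/
def IsMeasuredLamination (μ : GeodesicCurrent Γ) : Prop :=
  ∃ (Λ : GeodesicLamination Γ) (m : Λ.TransverseMeasure), μ.IsCurrentOf Λ m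

end GeodesicCurrent

end

noncomputable section

/-! ### Convexity of the half-plane in the coordinates `(Re z, |z|²)` -/

/-! In the coordinates `(Re z, |z|²)` the half-plane is the convex region above a parabola, and each
geodesic is the zero set of the affine function `eqn`, so crossings can be treated as crossings of
straight lines. The pseudo-distance is the `μ`-integral of `sepDist`, half the difference of the
signs of `eqn` at the two points (`pdist_eq_integral`, `sepDist_eq_sign`). The four-point condition
thus becomes a comparison of sign patterns, one geodesic at a time.

Lamination implies tree: if the sum for `xy|zw` exceeded both other sums, comparing integrals would
give one leaf separating `{x, z}` from `{y, w}` and another separating `{x, w}` from `{y, z}`. Two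
such lines cross (`ne_and_not_disjoint_of_split`), while leaves are disjoint.

Tree implies lamination: suppose two geodesics in the support of `μ` cross. A small affine
parallelogram around the crossing has one vertex in each of the four sectors. No geodesic
contributes more to a pair of opposite sides than to the two diagonals
(`sepDist_add_le_of_midpoint`), and near each of the two geodesics an open set of positive mass
makes one of the comparisons strict (`pdist_add_lt`). The diagonal sum then strictly exceeds both
side sums, against the four-point condition. So the support consists of disjoint geodesics; being
closed and `Γ`-invariant, it is a lamination.

Its transverse measure integrates over `μ` the counting measure on the crossings with an arc;
counting is needed because an arc may meet one leaf several times. The leaf through a point varies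
continuously along the lamination, and by Rolle's theorem transversality cuts an arc into finitely
many Borel pieces, each meeting every leaf at most once (`exists_partition`). This gives
measurability and, with compactness of the set of geodesics meeting an arc, finiteness. The support
is all of `α ∩ Λ` because a transverse crossing persists for nearby geodesics. -/

/-- The squared modulus, the second of the two coordinates in which geodesics are straight. -/
def UpperHalfPlane.absSq (z : ℍ) : ℝ := z.re ^ 2 + z.im ^ 2

/-- The coefficients `(A, B, D)` of the equation `A |z|² + B Re z + D` of a pair of boundary
points. -/
def pairCoeff (p : OnePoint ℝ × OnePoint ℝ) : ℝ × ℝ × ℝ :=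
  ((bdryCoord p.1).2 * (bdryCoord p.2).2,
    -((bdryCoord p.1).1 * (bdryCoord p.2).2 + (bdryCoord p.1).2 * (bdryCoord p.2).1),
    (bdryCoord p.1).1 * (bdryCoord p.2).1)

lemma pairEqn_eq_pairCoeff (a b : OnePoint ℝ) (z : ℍ) :
    pairEqn a b z = (pairCoeff (a, b)).1 * z.absSq + (pairCoeff (a, b)).2.1 * z.re
      + (pairCoeff (a, b)).2.2 := by
  simp only [pairEqn, pairCoeff, UpperHalfPlane.absSq]; ring

/-- The region above the parabola `v = u²` is the whole image of the half-plane in these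
coordinates. -/
lemma UpperHalfPlane.exists_re_eq_absSq_eq {u v : ℝ} (h : u ^ 2 < v) :
    ∃ z : ℍ, z.re = u ∧ z.absSq = v := by
  refine ⟨⟨⟨u, √(v - u ^ 2)⟩, Real.sqrt_pos.2 (sub_pos.2 h)⟩, rfl, ?_⟩
  show u ^ 2 + √(v - u ^ 2) ^ 2 = v
  rw [Real.sq_sqrt (sub_pos.2 h).le]; ring

lemma UpperHalfPlane.re_sq_lt_absSq (z : ℍ) : z.re ^ 2 < z.absSq := by
  have := pow_pos z.im_pos 2
  simp only [absSq]; linarith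

namespace HypGeodesic

/-- The coefficients `(A, B, D)` of the equation `A |z|² + B Re z + D` of a geodesic. -/
def coeff (γ : HypGeodesic) : ℝ × ℝ × ℝ :=
  Quotient.lift (fun p : BoundaryPair => pairCoeff p.1)
    (by
      rintro p q (h | h)
      · rw [h]
      · subst h
        simp only [pairCoeff, BoundaryPair.flip]
        ext <;> simp <;> ring) γ

lemma eqn_eq_coeff (γ : HypGeodesic) (z : ℍ) :
    γ.eqn z = γ.coeff.1 * z.absSq + γ.coeff.2.1 * z.re + γ.coeff.2.2 := by
  induction γ using Quotient.inductionOn with | _ p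
  exact pairEqn_eq_pairCoeff _ _ z

/-- The region above a parabola is convex, and one point serves all geodesics at once because every
equation is affine in the coordinates. -/
lemma exists_eqn_eq_convexComb (x y : ℍ) {t : ℝ} (h0 : 0 ≤ t) (h1 : t ≤ 1) :
    ∃ z : ℍ, ∀ γ : HypGeodesic, γ.eqn z = (1 - t) * γ.eqn x + t * γ.eqn y := by
  have hx := x.re_sq_lt_absSq
  have hy := y.re_sq_lt_absSq
  obtain ⟨z, hz1, hz2⟩ := UpperHalfPlane.exists_re_eq_absSq_eq
    (u := (1 - t) * x.re + t * y.re) (v := (1 - t) * x.absSq + t * y.absSq) (by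
      have h3 : 0 ≤ t * (1 - t) * (x.re - y.re) ^ 2 :=
        mul_nonneg (mul_nonneg h0 (by linarith)) (sq_nonneg _)
      rcases h0.eq_or_lt with h | h
      · subst h; simpa using hx
      · have := mul_lt_mul_of_pos_left hy h
        have := mul_le_mul_of_nonneg_left hx.le (sub_nonneg.2 h1)
        linarith)
  refine ⟨z, fun γ => ?_⟩
  rw [eqn_eq_coeff, eqn_eq_coeff, eqn_eq_coeff, hz1, hz2]; ring

/-- A weighted mean of two points on opposite sides of a geodesic lies on the geodesic. -/
lemma exists_mem_carrier_between {γ : HypGeodesic} {x y : ℍ} {c : ℝ} (hx : c * γ.eqn x < 0)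
    (hy : 0 ≤ c * γ.eqn y) :
    ∃ t : ℝ, 0 ≤ t ∧ t ≤ 1 ∧ ∃ z : ℍ, z ∈ γ.carrier ∧
      ∀ γ' : HypGeodesic, γ'.eqn z = (1 - t) * γ'.eqn x + t * γ'.eqn y := by
  have hc : c ≠ 0 := by rintro rfl; simp at hx
  have hd : 0 < c * γ.eqn y - c * γ.eqn x := by linarith
  have h0 : 0 ≤ -(c * γ.eqn x) / (c * γ.eqn y - c * γ.eqn x) := div_nonneg (by linarith) hd.le
  have h1 : -(c * γ.eqn x) / (c * γ.eqn y - c * γ.eqn x) ≤ 1 := by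
    rw [div_le_one hd]; linarith
  obtain ⟨z, hz⟩ := exists_eqn_eq_convexComb x y h0 h1
  refine ⟨_, h0, h1, z, ?_, hz⟩
  show γ.eqn z = 0
  rw [hz]
  have hd' : γ.eqn y - γ.eqn x ≠ 0 := fun h => hd.ne' (by rw [← mul_sub, h, mul_zero])
  field_simp
  ring

/-- Two geodesics that separate four points in two different ways cross. -/
lemma ne_and_not_disjoint_of_split {γ γ' : HypGeodesic} {x y z w : ℍ} {c c' : ℝ}
    (hx : c * γ.eqn x < 0) (hy : c * γ.eqn y < 0) (hz : 0 ≤ c * γ.eqn z) (hw : 0 ≤ c * γ.eqn w)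
    (hx' : c' * γ'.eqn x < 0) (hz' : c' * γ'.eqn z < 0) (hy' : 0 ≤ c' * γ'.eqn y)
    (hw' : 0 ≤ c' * γ'.eqn w) :
    γ ≠ γ' ∧ ¬ Disjoint γ.carrier γ'.carrier := by
  constructor
  · rintro rfl
    rcases mul_neg_iff.1 hx with ⟨h1, h2⟩ | ⟨h1, h2⟩ <;>
      rcases mul_neg_iff.1 hx' with ⟨h3, h4⟩ | ⟨h3, h4⟩
    · have := neg_of_mul_neg_right hy h1.le
      exact absurd hy' (not_le.2 (mul_neg_of_pos_of_neg h3 this))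
    · linarith
    · linarith
    · have := pos_of_mul_neg_right hy h1.le
      exact absurd hy' (not_le.2 (mul_neg_of_neg_of_pos h3 this))
  -- The line of `γ` meets the segment `xz` at `p` and the segment `yw` at `q`. These lie on
  -- opposite (weak) sides of `γ'`, so `γ'` passes through a point between `p` and `q`, which is
  -- still on `γ`.
  · obtain ⟨s, hs0, hs1, p, hp, hp'⟩ := exists_mem_carrier_between hx hz
    obtain ⟨t, ht0, ht1, q, hq, hq'⟩ := exists_mem_carrier_between hy hw
    have h1 : c' * γ'.eqn p < 0 := by
      rw [hp']
      rcases hs0.eq_or_lt with h | h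
      · subst h; simpa using hx'
      · have := mul_neg_of_pos_of_neg h hz'
        have := mul_nonpos_of_nonneg_of_nonpos (sub_nonneg.2 hs1) hx'.le
        linarith
    have h2 : 0 ≤ c' * γ'.eqn q := by
      rw [hq']
      have := mul_nonneg ht0 hw'
      have := mul_nonneg (sub_nonneg.2 ht1) hy'
      linarith
    obtain ⟨r, -, -, o, ho, ho'⟩ := exists_mem_carrier_between h1 h2
    refine not_disjoint_iff.2 ⟨o, ?_, ho⟩
    show γ.eqn o = 0
    have hp : γ.eqn p = 0 := hp
    have hq : γ.eqn q = 0 := hq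
    rw [ho', hp, hq]; ring

/-! ### The pseudo-distance as an integral -/

/-- The pseudo-distance of the unit mass at a geodesic. -/
def sepDist (γ : HypGeodesic) (x y : ℍ) : ℝ :=
  (1 / 2) * ((transversal (hypIco x y)).indicator 1 γ + (transversal (hypIco y x)).indicator 1 γ)

/-- A geodesic through exactly one of the two points lies in only one of the two half-open
transversals and so counts `1/2`, matching a sign that moves from `0` to `±1`. -/
lemma sepDist_eq_sign (γ : HypGeodesic) (x y : ℍ) :
    γ.sepDist x y = |(SignType.sign (γ.eqn x) : ℝ) - SignType.sign (γ.eqn y)| / 2 := by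
  classical
  rw [sepDist, indicator_apply, indicator_apply, mem_transversal_hypIco, mem_transversal_hypIco]
  generalize γ.eqn x = a, γ.eqn y = b
  have htri : ∀ a : ℝ, (a < 0 ∧ ¬ 0 < a ∧ a ≠ 0) ∨ a = 0 ∨ (0 < a ∧ ¬ a < 0 ∧ a ≠ 0) := by
    intro a
    rcases lt_trichotomy a 0 with h | h | h
    · exact Or.inl ⟨h, h.not_gt, h.ne⟩
    · exact Or.inr (Or.inl h)
    · exact Or.inr (Or.inr ⟨h, h.not_gt, h.ne'⟩)
  rcases htri a with ⟨ha, ha', ha''⟩ | ha | ⟨ha, ha', ha''⟩ <;>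
    rcases htri b with ⟨hb, hb', hb''⟩ | hb | ⟨hb, hb', hb''⟩ <;>
    simp [*, mul_neg_iff] <;> norm_num

lemma sepDist_comm (γ : HypGeodesic) (x y : ℍ) : γ.sepDist x y = γ.sepDist y x := by
  rw [sepDist, sepDist, add_comm]

end HypGeodesic

/-! ### Sign patterns in the four-point condition -/

/-- The sign pattern forced by a strict inequality between two of the sums in the four-point
condition. -/
lemma split_of_sign_lt {a b c d : ℝ}
    (h : |(SignType.sign a : ℝ) - SignType.sign c| / 2 + |(SignType.sign b : ℝ) - SignType.sign d| / 2
      < |(SignType.sign a : ℝ) - SignType.sign b| / 2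
        + |(SignType.sign c : ℝ) - SignType.sign d| / 2) :
    ∃ e : ℝ, (e * a < 0 ∧ e * c < 0 ∧ 0 ≤ e * b ∧ 0 ≤ e * d) ∨
      (e * b < 0 ∧ e * d < 0 ∧ 0 ≤ e * a ∧ 0 ≤ e * c) := by
  -- All 81 sign patterns are checked. One pair always lies strictly on one side, but the other may
  -- touch the geodesic, hence the weak inequalities.
  rcases lt_trichotomy a 0 with ha | ha | ha <;> rcases lt_trichotomy b 0 with hb | hb | hb <;>
    rcases lt_trichotomy c 0 with hc | hc | hc <;> rcases lt_trichotomy d 0 with hd | hd | hd <;>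
    simp [ha, hb, hc, hd] at h <;>
    first
    | (exfalso; norm_num at h; done)
    | exact ⟨1, Or.inl ⟨by linarith, by linarith, by linarith, by linarith⟩⟩
    | exact ⟨1, Or.inr ⟨by linarith, by linarith, by linarith, by linarith⟩⟩
    | exact ⟨-1, Or.inl ⟨by linarith, by linarith, by linarith, by linarith⟩⟩
    | exact ⟨-1, Or.inr ⟨by linarith, by linarith, by linarith, by linarith⟩⟩

namespace HypGeodesic

/-- Disjoint geodesics separate four points in compatible ways. -/
lemma not_disjoint_of_sepDist_lt {γ γ' : HypGeodesic} {x y z w : ℍ}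
    (h : γ.sepDist x z + γ.sepDist y w < γ.sepDist x y + γ.sepDist z w)
    (h' : γ'.sepDist y z + γ'.sepDist x w < γ'.sepDist x y + γ'.sepDist z w) :
    γ ≠ γ' ∧ ¬ Disjoint γ.carrier γ'.carrier := by
  rw [add_comm, sepDist_comm γ' z w] at h'
  simp only [sepDist_eq_sign] at h h'
  obtain ⟨c, ⟨h1, h2, h3, h4⟩ | ⟨h1, h2, h3, h4⟩⟩ := split_of_sign_lt h <;>
    obtain ⟨c', ⟨h5, h6, h7, h8⟩ | ⟨h5, h6, h7, h8⟩⟩ := split_of_sign_lt h'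
  · exact ne_and_not_disjoint_of_split h1 h2 h4 h3 h5 h6 h8 h7
  · exact ne_and_not_disjoint_of_split h2 h1 h3 h4 h6 h5 h7 h8
  · exact ne_and_not_disjoint_of_split h2 h1 h3 h4 h6 h5 h7 h8
  · exact ne_and_not_disjoint_of_split h1 h2 h4 h3 h5 h6 h8 h7

end HypGeodesic

/-! ### The four-point condition for currents on disjoint geodesics -/

namespace GeodesicCurrent

variable {Γ : Subgroup SL(2, ℝ)} (μ : GeodesicCurrent Γ)

lemma integrable_sepDist (x y : ℍ) : Integrable (fun γ => γ.sepDist x y) μ.toMeasure := by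
  have h : ∀ x y : ℍ, Integrable ((transversal (hypIco x y)).indicator (1 : HypGeodesic → ℝ))
      μ.toMeasure := fun x y =>
    (integrable_indicator_iff (measurableSet_transversal_hypIco x y)).2
      (integrableOn_const (μ.measure_transversal_lt_top x y).ne)
  exact ((h x y).add (h y x)).const_mul _

lemma pdist_eq_integral (x y : ℍ) : μ.pdist x y = ∫ γ, γ.sepDist x y ∂μ.toMeasure := by
  have h : ∀ x y : ℍ, Integrable ((transversal (hypIco x y)).indicator (1 : HypGeodesic → ℝ))
      μ.toMeasure := fun x y =>
    (integrable_indicator_iff (measurableSet_transversal_hypIco x y)).2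
      (integrableOn_const (μ.measure_transversal_lt_top x y).ne)
  simp only [HypGeodesic.sepDist]
  rw [integral_const_mul, integral_add (h x y) (h y x),
    integral_indicator_one (measurableSet_transversal_hypIco x y),
    integral_indicator_one (measurableSet_transversal_hypIco y x), pdist, hypIoc_eq]
  rfl

lemma pdist_add_eq_integral (x y z w : ℍ) : μ.pdist x y + μ.pdist z w
    = ∫ γ, γ.sepDist x y + γ.sepDist z w ∂μ.toMeasure := by
  rw [integral_add (μ.integrable_sepDist x y) (μ.integrable_sepDist z w), pdist_eq_integral,
    pdist_eq_integral]

/-- The four-point condition for a current concentrated on pairwise disjoint geodesics. -/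
lemma pdist_four_point {s : Set HypGeodesic} (hs : μ.toMeasure sᶜ = 0)
    (hd : ∀ γ ∈ s, ∀ γ' ∈ s, γ ≠ γ' → Disjoint γ.carrier γ'.carrier) (x y z w : ℍ) :
    μ.pdist x y + μ.pdist z w ≤ max (μ.pdist x z + μ.pdist y w) (μ.pdist y z + μ.pdist x w) := by
  -- A strict inequality of integrals is strict pointwise somewhere on the conull set `s`.
  have key : ∀ a b c d : ℍ, μ.pdist a b + μ.pdist c d < μ.pdist x y + μ.pdist z w →
      ∃ γ ∈ s, γ.sepDist a b + γ.sepDist c d < γ.sepDist x y + γ.sepDist z w := by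
    intro a b c d h
    by_contra! hcon
    refine absurd h (not_lt.2 ?_)
    rw [pdist_add_eq_integral, pdist_add_eq_integral]
    refine integral_mono_ae ((μ.integrable_sepDist _ _).add (μ.integrable_sepDist _ _))
      ((μ.integrable_sepDist _ _).add (μ.integrable_sepDist _ _)) ?_
    have : ∀ᵐ γ ∂μ.toMeasure, γ ∈ s := hs
    filter_upwards [this] with γ hγ using hcon γ hγ
  by_contra! h
  obtain ⟨h1, h2⟩ := max_lt_iff.1 h
  obtain ⟨γ, hγ, h1⟩ := key _ _ _ _ h1
  obtain ⟨γ', hγ', h2⟩ := key _ _ _ _ h2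
  obtain ⟨h3, h4⟩ := HypGeodesic.not_disjoint_of_sepDist_lt h1 h2
  exact h4 (hd γ hγ γ' hγ' h3)

/-- The dual space is `0`-hyperbolic iff the pseudo-distance satisfies the four-point condition. -/
lemma isDeltaHyperbolic_zero_iff : IsDeltaHyperbolic 0 (DualSpace μ) ↔ ∀ x y z w : ℍ,
    μ.pdist x y + μ.pdist z w
      ≤ max (μ.pdist x z + μ.pdist y w) (μ.pdist y z + μ.pdist x w) := by
  have hdist : ∀ x y : ℍ, dist (SeparationQuotient.mk (X := DualCover μ) x)
      (SeparationQuotient.mk (X := DualCover μ) y) = μ.pdist x y := fun x y =>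
    SeparationQuotient.dist_mk (α := DualCover μ) x y
  constructor
  · intro h x y z w
    have := (h (SeparationQuotient.mk (X := DualCover μ) x) (SeparationQuotient.mk y)
      (SeparationQuotient.mk z) (SeparationQuotient.mk w)).1
    simpa only [hdist, mul_zero, add_zero] using this
  · intro h x y z w
    obtain ⟨x, rfl⟩ := SeparationQuotient.surjective_mk x
    obtain ⟨y, rfl⟩ := SeparationQuotient.surjective_mk y
    obtain ⟨z, rfl⟩ := SeparationQuotient.surjective_mk z
    obtain ⟨w, rfl⟩ := SeparationQuotient.surjective_mk w
    -- Permuting the four points turns the single inequality into all three.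
    have h1 := h x y z w
    have h2 := h x z y w
    have h3 := h y z x w
    rw [μ.pdist_comm z y] at h2
    rw [μ.pdist_comm y x, μ.pdist_comm z x] at h3
    rw [mul_zero, add_zero, add_zero, add_zero]
    exact ⟨h1, h2, h3⟩

/-- Only the concentration of `μ` on the leaves and their disjointness enter; the transverse measure
plays no role. -/
lemma IsMeasuredLamination.isDeltaHyperbolic {μ : GeodesicCurrent Γ}
    (h : μ.IsMeasuredLamination) : IsDeltaHyperbolic 0 (DualSpace μ) := by
  obtain ⟨Λ, m, h0, -⟩ := h
  exact μ.isDeltaHyperbolic_zero_iff.2 (μ.pdist_four_point h0 Λ.disjoint)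

end GeodesicCurrent

/-! ### Topology of the boundary and of the space of geodesics -/

/-- The normalized quadratic monomials in the homogeneous coordinates of a boundary point. -/
def bdryMoment (a : OnePoint ℝ) : ℝ × ℝ × ℝ :=
  ((bdryCoord a).1 ^ 2 / bdryNorm a, (bdryCoord a).1 * (bdryCoord a).2 / bdryNorm a,
    (bdryCoord a).2 ^ 2 / bdryNorm a)

lemma continuous_bdryMoment : Continuous bdryMoment :=
  continuous_bdry₁₁.prodMk (continuous_bdry₁₂.prodMk continuous_bdry₂₂)

/-- This is the Veronese map of the projective line: quadratic monomials determine a point of the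
line without a choice of sign for its coordinates. -/
lemma injective_bdryMoment : Function.Injective bdryMoment := by
  intro a b h
  simp only [bdryMoment, Prod.mk.injEq] at h
  obtain ⟨h1, h2, h3⟩ := h
  induction a using OnePoint.rec with
  | infty =>
    induction b using OnePoint.rec with
    | infty => rfl
    | coe y =>
      have : 1 + y ^ 2 ≠ 0 := by positivity
      simp [bdryNorm, bdryCoord] at h3
      exact absurd h3 (by positivity)
  | coe x =>
    induction b using OnePoint.rec with
    | infty =>
      simp [bdryNorm, bdryCoord] at h3
      exact absurd h3 (by positivity)
    | coe y =>
      simp only [bdryNorm, bdryCoord, OnePoint.elim_some, mul_one, one_pow] at h2 h3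
      have h4 : x ^ 2 + 1 = y ^ 2 + 1 := inv_injective (by simpa only [one_div] using h3)
      rw [h4] at h2
      have : y ^ 2 + 1 ≠ 0 := by positivity
      rw [div_left_inj' this] at h2
      rw [h2]

lemma isClosedEmbedding_bdryMoment : Topology.IsClosedEmbedding bdryMoment :=
  continuous_bdryMoment.isClosedEmbedding injective_bdryMoment

/-- Second countability passes on to the space of geodesics, where it makes the support of a measure
conull. -/
instance : SecondCountableTopology (OnePoint ℝ) :=
  isClosedEmbedding_bdryMoment.isEmbedding.secondCountableTopology

/-! ### The Möbius action on boundary points and geodesics -/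

/-- The linear action on homogeneous coordinates induces the action on boundary points. -/
lemma bdryCoord_smul (g : GL (Fin 2) ℝ) (a : OnePoint ℝ) : ∃ c : ℝ, c ≠ 0 ∧
    g 0 0 * (bdryCoord a).1 + g 0 1 * (bdryCoord a).2 = c * (bdryCoord (g • a)).1 ∧
    g 1 0 * (bdryCoord a).1 + g 1 1 * (bdryCoord a).2 = c * (bdryCoord (g • a)).2 := by
  have hdet : g 0 0 * g 1 1 - g 0 1 * g 1 0 ≠ 0 := by
    rw [← Matrix.det_fin_two]
    exact g.det_ne_zero
  induction a using OnePoint.rec with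
  | infty =>
    rw [OnePoint.smul_infty_eq_ite]
    split_ifs with h
    · refine ⟨g 0 0, fun h0 => hdet (by rw [h, h0]; ring), ?_, ?_⟩ <;> simp [bdryCoord, h]
    · refine ⟨g 1 0, h, ?_, ?_⟩ <;> simp [bdryCoord]
      field_simp
  | coe x =>
    rw [OnePoint.smul_some_eq_ite]
    split_ifs with h
    · refine ⟨g 0 0 * x + g 0 1, fun h0 => ?_, ?_, ?_⟩
      · by_cases h10 : g 1 0 = 0
        · rw [h10] at h hdet
          have : g 1 1 = 0 := by linarith
          exact hdet (by rw [this]; ring)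
        · refine hdet (mul_left_cancel₀ h10 ?_)
          linear_combination (g 0 0 * g 1 0) * h - g 1 0 ^ 2 * h0
      · simp [bdryCoord]
      · simpa [bdryCoord] using h
    · refine ⟨g 1 0 * x + g 1 1, h, ?_, ?_⟩ <;> simp [bdryCoord]
      rw [mul_div_cancel₀ _ h]

/-- The moments of `g • a` are quotients of linear combinations of the moments of `a`; the unknown
scale factor between the coordinate vectors cancels in the quotient. -/
lemma continuous_smul_bdry (g : GL (Fin 2) ℝ) : Continuous (fun a : OnePoint ℝ => g • a) := by
  rw [isClosedEmbedding_bdryMoment.isEmbedding.continuous_iff]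
  have h1 := continuous_bdry₁₁
  have h2 := continuous_bdry₁₂
  have h3 := continuous_bdry₂₂
  let P : ℝ → ℝ → OnePoint ℝ → ℝ := fun s t a => s ^ 2 * ((bdryCoord a).1 ^ 2 / bdryNorm a)
    + 2 * (s * t) * ((bdryCoord a).1 * (bdryCoord a).2 / bdryNorm a)
    + t ^ 2 * ((bdryCoord a).2 ^ 2 / bdryNorm a)
  have hP : ∀ s t, Continuous (P s t) := fun s t => by fun_prop
  have hPe : ∀ s t a, P s t a = (s * (bdryCoord a).1 + t * (bdryCoord a).2) ^ 2 / bdryNorm a :=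
    fun s t a => by simp only [P]; ring
  -- Polarization recovers the mixed monomial of the transformed coordinates from squares.
  let M : OnePoint ℝ → ℝ := fun a => (P (g 0 0 + g 1 0) (g 0 1 + g 1 1) a - P (g 0 0) (g 0 1) a
    - P (g 1 0) (g 1 1) a) / 2
  have hM : Continuous M := by fun_prop
  have hMe : ∀ a, M a = (g 0 0 * (bdryCoord a).1 + g 0 1 * (bdryCoord a).2)
      * (g 1 0 * (bdryCoord a).1 + g 1 1 * (bdryCoord a).2) / bdryNorm a := fun a => by
    simp only [M, hPe]; ring
  let N : OnePoint ℝ → ℝ := fun a => P (g 0 0) (g 0 1) a + P (g 1 0) (g 1 1) a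
  have hN : Continuous N := by fun_prop
  have key : ∀ a, ∃ k : ℝ, k ≠ 0 ∧ P (g 0 0) (g 0 1) a = k * (bdryCoord (g • a)).1 ^ 2 ∧
      M a = k * ((bdryCoord (g • a)).1 * (bdryCoord (g • a)).2) ∧
      P (g 1 0) (g 1 1) a = k * (bdryCoord (g • a)).2 ^ 2 ∧ N a = k * bdryNorm (g • a) := by
    intro a
    obtain ⟨c, hc, h1, h2⟩ := bdryCoord_smul g a
    refine ⟨c ^ 2 / bdryNorm a, div_ne_zero (pow_ne_zero 2 hc) (bdryNorm_pos a).ne', ?_, ?_, ?_, ?_⟩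
    · rw [hPe, h1]; ring
    · rw [hMe, h1, h2]; ring
    · rw [hPe, h2]; ring
    · simp only [N]; rw [hPe, hPe, h1, h2]; rw [bdryNorm.eq_1 (g • a)]; ring
  have hN0 : ∀ a, N a ≠ 0 := by
    intro a
    obtain ⟨k, hk, -, -, -, h⟩ := key a
    rw [h]
    exact mul_ne_zero hk (bdryNorm_pos _).ne'
  have : Continuous fun a => (P (g 0 0) (g 0 1) a / N a, M a / N a, P (g 1 0) (g 1 1) a / N a) :=
    ((hP _ _).div hN hN0).prodMk ((hM.div hN hN0).prodMk ((hP _ _).div hN hN0))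
  refine this.congr fun a => ?_
  obtain ⟨k, hk, h1, h2, h3, h4⟩ := key a
  simp only [Function.comp, bdryMoment]
  rw [h1, h2, h3, h4, mul_div_mul_left _ _ hk, mul_div_mul_left _ _ hk, mul_div_mul_left _ _ hk]

namespace HypGeodesic

lemma continuous_flip : Continuous BoundaryPair.flip :=
  Continuous.subtype_mk ((continuous_snd.comp continuous_subtype_val).prodMk
    (continuous_fst.comp continuous_subtype_val)) _

/-- The saturation of an open set is its union with its preimage under the continuous flip. -/
lemma isOpenMap_mk : IsOpenMap (Quotient.mk' : BoundaryPair → HypGeodesic) := by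
  intro U hU
  rw [← isQuotientMap_quotient_mk'.isOpen_preimage]
  have : (Quotient.mk' : BoundaryPair → HypGeodesic) ⁻¹' (Quotient.mk' '' U)
      = U ∪ BoundaryPair.flip ⁻¹' U := by
    ext p
    constructor
    · rintro ⟨q, hq, h⟩
      rcases (Quotient.exact h : q = p ∨ q = p.flip) with rfl | rfl
      · exact Or.inl hq
      · exact Or.inr hq
    · rintro (h | h)
      · exact ⟨p, h, rfl⟩
      · exact ⟨p.flip, h, Quotient.sound (Or.inr rfl)⟩
  rw [this]
  exact hU.union (hU.preimage continuous_flip)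

instance : SecondCountableTopology BoundaryPair :=
  Topology.IsEmbedding.subtypeVal.secondCountableTopology

instance : SecondCountableTopology HypGeodesic :=
  TopologicalSpace.Quotient.secondCountableTopology isOpenMap_mk

lemma continuous_act (g : SL(2, ℝ)) : Continuous (act g) := by
  refine Continuous.quotient_map' ?_ _
  have h := continuous_smul_bdry (g : GL (Fin 2) ℝ)
  exact Continuous.subtype_mk (((h.comp continuous_fst).comp continuous_subtype_val).prodMk
    ((h.comp continuous_snd).comp continuous_subtype_val)) _

/-- The action on geodesics is the action on their carriers. -/
lemma smul_mem_carrier_act (g : SL(2, ℝ)) (γ : HypGeodesic) (z : ℍ) :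
    g • z ∈ (act g γ).carrier ↔ z ∈ γ.carrier := by
  induction γ using Quotient.inductionOn with | _ p
  obtain ⟨⟨a, b⟩, hab⟩ := p
  show pairEqn ((g : GL (Fin 2) ℝ) • a) ((g : GL (Fin 2) ℝ) • b) (g • z) = 0 ↔ pairEqn a b z = 0
  obtain ⟨c, hc, h1, h2⟩ := bdryCoord_smul (g : GL (Fin 2) ℝ) a
  obtain ⟨d, hd, h3, h4⟩ := bdryCoord_smul (g : GL (Fin 2) ℝ) b
  have hdet : g 0 0 * g 1 1 - g 0 1 * g 1 0 = 1 := by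
    rw [← Matrix.det_fin_two]
    exact g.det_coe
  have hz := UpperHalfPlane.coe_specialLinearGroup_apply g z
  set w := g • z with hw
  simp only [Algebra.algebraMap_self, RingHom.id_apply,
    Matrix.SpecialLinearGroup.coe_GL_coe_matrix] at h1 h2 h3 h4 hz
  generalize g 0 0 = α, g 0 1 = β, g 1 0 = κ, g 1 1 = δ at *
  have hδ : (κ * z + δ : ℂ) ≠ 0 := by
    intro h
    have him := congrArg Complex.im h
    have hre := congrArg Complex.re h
    simp at him hre
    rcases him with rfl | him
    · simp at hre
      subst hre
      simp at hdet
    · exact z.im_pos.ne' him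
  rw [eq_div_iff hδ] at hz
  have hre := congrArg Complex.re hz
  have him := congrArg Complex.im hz
  simp at hre him
  simp only [pairEqn]
  set x := z.re
  set y := z.im
  set u := w.re
  set v := w.im
  have hpos : κ * x + δ ≠ 0 ∨ κ * y ≠ 0 := by
    by_contra! h
    exact hδ (Complex.ext (by simpa using h.1) (by simpa using h.2))
  have hm : (κ * x + δ) ^ 2 + (κ * y) ^ 2 ≠ 0 := by
    rcases hpos with h | h
    · positivity
    · positivity
  have hu : u * ((κ * x + δ) ^ 2 + (κ * y) ^ 2) = (α * x + β) * (κ * x + δ) + α * y * (κ * y) := by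
    linear_combination (κ * x + δ) * hre + κ * y * him
  have huv : (u ^ 2 + v ^ 2) * ((κ * x + δ) ^ 2 + (κ * y) ^ 2)
      = (α * x + β) ^ 2 + (α * y) ^ 2 := by
    linear_combination (u * (κ * x + δ) - v * (κ * y) + (α * x + β)) * hre
      + (u * (κ * y) + v * (κ * x + δ) + α * y) * him
  -- Up to the nonzero factor `c d |κz + δ|²`, the equation of the image geodesic at `g • z` is the
  -- original equation at `z`.
  have e : c * d * ((κ * x + δ) ^ 2 + (κ * y) ^ 2)
      * ((bdryCoord ((g : GL (Fin 2) ℝ) • a)).2 * (bdryCoord ((g : GL (Fin 2) ℝ) • b)).2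
          * (u ^ 2 + v ^ 2)
        - ((bdryCoord ((g : GL (Fin 2) ℝ) • a)).1 * (bdryCoord ((g : GL (Fin 2) ℝ) • b)).2
          + (bdryCoord ((g : GL (Fin 2) ℝ) • a)).2 * (bdryCoord ((g : GL (Fin 2) ℝ) • b)).1) * u
        + (bdryCoord ((g : GL (Fin 2) ℝ) • a)).1 * (bdryCoord ((g : GL (Fin 2) ℝ) • b)).1)
      = (bdryCoord a).2 * (bdryCoord b).2 * (x ^ 2 + y ^ 2)
        - ((bdryCoord a).1 * (bdryCoord b).2 + (bdryCoord a).2 * (bdryCoord b).1) * x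
        + (bdryCoord a).1 * (bdryCoord b).1 := by
    generalize (bdryCoord ((g : GL (Fin 2) ℝ) • a)).1 = a1',
      (bdryCoord ((g : GL (Fin 2) ℝ) • a)).2 = a2',
      (bdryCoord ((g : GL (Fin 2) ℝ) • b)).1 = b1',
      (bdryCoord ((g : GL (Fin 2) ℝ) • b)).2 = b2',
      (bdryCoord a).1 = a1, (bdryCoord a).2 = a2, (bdryCoord b).1 = b1,
      (bdryCoord b).2 = b2 at *
    have e : c * d * ((κ * x + δ) ^ 2 + (κ * y) ^ 2)
        * (a2' * b2' * (u ^ 2 + v ^ 2) - (a1' * b2' + a2' * b1') * u + a1' * b1')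
        = (c * a2') * (d * b2') * ((u ^ 2 + v ^ 2) * ((κ * x + δ) ^ 2 + (κ * y) ^ 2))
          - ((c * a1') * (d * b2') + (c * a2') * (d * b1'))
            * (u * ((κ * x + δ) ^ 2 + (κ * y) ^ 2))
          + (c * a1') * (d * b1') * ((κ * x + δ) ^ 2 + (κ * y) ^ 2) := by ring
    rw [e, hu, huv, ← h1, ← h2, ← h3, ← h4]
    -- The transformed equation carries the factor `det² = 1`, and `det² - 1 = (det - 1)(det + 1)`.
    linear_combination (a2 * b2 * (x ^ 2 + y ^ 2) - (a1 * b2 + a2 * b1) * x + a1 * b1)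
      * (α * δ - β * κ + 1) * hdet
  rw [← e, mul_eq_zero, or_iff_right (mul_ne_zero (mul_ne_zero hc hd) hm)]

end HypGeodesic

/-! ### Incidence as a closed condition, and geodesics determined by their equations -/

/-- The value of a linear form on the coefficients of a geodesic. -/
def coeffForm (l c : ℝ × ℝ × ℝ) : ℝ := l.1 * c.1 + l.2.1 * c.2.1 + l.2.2 * c.2.2

/-- The chosen homogeneous coordinates are not continuous at `∞`, so the form itself need not be.
Its square divided by the norms of the coordinates is a polynomial in the form's coefficients and
the continuous moments. -/
lemma isOpen_coeffForm_pairCoeff_ne : IsOpen {q : (ℝ × ℝ × ℝ) × (OnePoint ℝ × OnePoint ℝ) |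
    coeffForm q.1 (pairCoeff q.2) ≠ 0} := by
  have h1 := continuous_bdry₁₁
  have h2 := continuous_bdry₁₂
  have h3 := continuous_bdry₂₂
  let P := fun a : OnePoint ℝ => (bdryCoord a).1 ^ 2 / bdryNorm a
  let Q := fun a : OnePoint ℝ => (bdryCoord a).1 * (bdryCoord a).2 / bdryNorm a
  let R := fun a : OnePoint ℝ => (bdryCoord a).2 ^ 2 / bdryNorm a
  have hP : Continuous P := h1
  have hQ : Continuous Q := h2
  have hR : Continuous R := h3
  let F : (ℝ × ℝ × ℝ) × (OnePoint ℝ × OnePoint ℝ) → ℝ := fun q =>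
    q.1.1 ^ 2 * (R q.2.1 * R q.2.2)
      - 2 * q.1.1 * q.1.2.1 * (Q q.2.1 * R q.2.2 + R q.2.1 * Q q.2.2)
      + 2 * q.1.1 * q.1.2.2 * (Q q.2.1 * Q q.2.2)
      + q.1.2.1 ^ 2 * (P q.2.1 * R q.2.2 + 2 * (Q q.2.1 * Q q.2.2) + R q.2.1 * P q.2.2)
      - 2 * q.1.2.1 * q.1.2.2 * (P q.2.1 * Q q.2.2 + Q q.2.1 * P q.2.2)
      + q.1.2.2 ^ 2 * (P q.2.1 * P q.2.2)
  have hF : Continuous F := by fun_prop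
  have hFe : ∀ q, F q = coeffForm q.1 (pairCoeff q.2) ^ 2 / (bdryNorm q.2.1 * bdryNorm q.2.2) := by
    intro q
    have hp := (bdryNorm_pos q.2.1).ne'
    have hq := (bdryNorm_pos q.2.2).ne'
    simp only [F, P, Q, R, coeffForm, pairCoeff]
    field_simp
    ring
  convert isOpen_ne_fun hF (continuous_const (y := (0 : ℝ))) using 1
  ext q
  have := mul_pos (bdryNorm_pos q.2.1) (bdryNorm_pos q.2.2)
  simp only [mem_ofPred_eq, hFe, ne_eq, div_eq_zero_iff, this.ne', or_false, pow_eq_zero_iff,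
    OfNat.ofNat_ne_zero, not_false_eq_true]

namespace HypGeodesic

lemma isOpen_coeffForm_ne :
    IsOpen {q : (ℝ × ℝ × ℝ) × HypGeodesic | coeffForm q.1 q.2.coeff ≠ 0} := by
  have h := isOpen_coeffForm_pairCoeff_ne.preimage
    ((continuous_fst (X := ℝ × ℝ × ℝ) (Y := BoundaryPair)).prodMk
      (continuous_subtype_val.comp continuous_snd))
  convert (IsOpenMap.id.prodMap isOpenMap_mk) _ h using 1
  ext ⟨l, γ⟩
  induction γ using Quotient.inductionOn with | _ p
  constructor
  · intro h
    exact ⟨(l, p), h, rfl⟩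
  · rintro ⟨⟨l', p'⟩, h, he⟩
    simp only [Prod.map, Prod.mk.injEq] at he
    obtain ⟨rfl, he⟩ := he
    show coeffForm l' (coeff (Quotient.mk _ p)) ≠ 0
    rw [← he]
    exact h

lemma coeff_cases (γ : HypGeodesic) :
    (∃ x y : ℝ, x ≠ y ∧ (∃ h, γ = Quotient.mk _ ⟨((x : OnePoint ℝ), (y : OnePoint ℝ)), h⟩)
      ∧ γ.coeff = (1, -(x + y), x * y)) ∨
    ∃ x : ℝ, (∃ h, γ = Quotient.mk _ ⟨((x : OnePoint ℝ), OnePoint.infty), h⟩) ∧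
      γ.coeff = (0, -1, x) := by
  induction γ using Quotient.inductionOn with | _ p
  obtain ⟨⟨a, b⟩, hab⟩ := p
  have hab' : a ≠ b := hab
  induction a using OnePoint.rec with
  | infty =>
    induction b using OnePoint.rec with
    | infty => exact absurd rfl hab'
    | coe y =>
      refine Or.inr ⟨y, ⟨OnePoint.coe_ne_infty y, Quotient.sound (Or.inr rfl)⟩, ?_⟩
      show pairCoeff _ = _
      simp [pairCoeff, bdryCoord]
  | coe x =>
    induction b using OnePoint.rec with
    | infty =>
      refine Or.inr ⟨x, ⟨OnePoint.coe_ne_infty x, rfl⟩, ?_⟩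
      show pairCoeff _ = _
      simp [pairCoeff, bdryCoord]
    | coe y =>
      refine Or.inl ⟨x, y, fun h => hab' (by rw [h]), ⟨hab', rfl⟩, ?_⟩
      show pairCoeff _ = _
      simp [pairCoeff, bdryCoord]

/-- A geodesic is determined by its equation up to a factor. -/
lemma eq_of_coeff_eq_smul {γ γ' : HypGeodesic} {c : ℝ} (h : γ'.coeff = c • γ.coeff) :
    γ = γ' := by
  rcases coeff_cases γ with ⟨x, y, -, ⟨hxy, h1⟩, h2⟩ | ⟨x, ⟨hx, h1⟩, h2⟩ <;>
    rcases coeff_cases γ' with ⟨x', y', -, ⟨hxy', h1'⟩, h2'⟩ | ⟨x', ⟨hx', h1'⟩, h2'⟩ <;>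
    rw [h2, h2'] at h <;>
    simp only [Prod.smul_mk, smul_eq_mul, Prod.mk.injEq] at h <;>
    obtain ⟨h3, h4, h5⟩ := h
  · have hc : c = 1 := by linarith
    subst hc
    have h6 : (x' - x) * (x' - y) = 0 := by
      linear_combination -x' * h4 - h5
    rcases mul_eq_zero.1 h6 with h7 | h7
    · obtain rfl : x' = x := by linarith
      obtain rfl : y' = y := by linarith
      rw [h1, h1']
    · obtain rfl : x' = y := by linarith
      obtain rfl : y' = x := by linarith
      rw [h1, h1']
      exact Quotient.sound (Or.inr rfl)
  · exfalso
    have : c = 0 := by linarith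
    subst this
    linarith
  · exfalso
    linarith
  · have hc : c = 1 := by linarith
    subst hc
    obtain rfl : x' = x := by linarith
    rw [h1, h1']

instance : T2Space HypGeodesic := by
  rw [t2Space_iff_of_isOpenQuotientMap (π := (Quotient.mk' : BoundaryPair → HypGeodesic))
    ⟨Quotient.mk'_surjective, continuous_quotient_mk', isOpenMap_mk⟩]
  convert (isClosed_eq continuous_fst continuous_snd).union
    (isClosed_eq (continuous_fst (X := BoundaryPair) (Y := BoundaryPair))
      (continuous_flip.comp continuous_snd)) using 1
  ext q
  exact Quotient.eq (r := BoundaryPair.setoid)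

end HypGeodesic

lemma UpperHalfPlane.continuous_absSq : Continuous absSq :=
  (continuous_re.pow 2).add (continuous_im.pow 2)

lemma isClosed_pairEqn_eq_zero :
    IsClosed {q : (OnePoint ℝ × OnePoint ℝ) × ℍ | pairEqn q.1.1 q.1.2 q.2 = 0} := by
  have hre := UpperHalfPlane.continuous_re
  have habs := UpperHalfPlane.continuous_absSq
  have h := isOpen_coeffForm_pairCoeff_ne.preimage
    (f := fun q : (OnePoint ℝ × OnePoint ℝ) × ℍ => ((q.2.absSq, q.2.re, 1), q.1)) (by fun_prop)
  rw [← isOpen_compl_iff]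
  convert h using 1
  ext q
  simp only [mem_compl_iff, mem_ofPred_eq, mem_preimage, coeffForm]
  rw [pairEqn_eq_pairCoeff, not_iff_not]
  ring_nf

/-- A degenerate pair has no points in `ℍ`. This lets closedness and compactness arguments run on
the full compact product of boundary circles. -/
lemma pairEqn_self_pos (a : OnePoint ℝ) (z : ℍ) : 0 < pairEqn a a z := by
  have hz := pow_pos z.im_pos 2
  induction a using OnePoint.rec with
  | infty => simp [pairEqn, bdryCoord]
  | coe t =>
    simp only [pairEqn, bdryCoord, OnePoint.elim_some]
    have := sq_nonneg (z.re - t)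
    linarith

namespace HypGeodesic

/-- The union of a closed set of geodesics is closed. -/
lemma isClosed_biUnion_carrier {C : Set HypGeodesic} (hC : IsClosed C) :
    IsClosed (⋃ γ ∈ C, γ.carrier) := by
  have hC' : IsClosed ((Quotient.mk' : BoundaryPair → HypGeodesic) ⁻¹' C) :=
    hC.preimage continuous_quotient_mk'
  obtain ⟨K, hK, hKC⟩ := isClosed_induced_iff.1 hC'
  -- The union is the projection of a closed incidence relation along the compact factor of endpoint
  -- pairs; limit pairs on the diagonal contribute nothing.
  convert isClosedMap_snd_of_compactSpace _
    (isClosed_pairEqn_eq_zero.inter (hK.preimage continuous_fst)) using 1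
  ext z
  simp only [mem_iUnion, mem_image, mem_inter_iff, mem_preimage, mem_ofPred_eq, Prod.exists,
    exists_eq_right, exists_prop]
  constructor
  · rintro ⟨γ, hγ, hz⟩
    induction γ using Quotient.inductionOn with | _ p
    have : p ∈ Subtype.val ⁻¹' K := by rw [hKC]; exact hγ
    exact ⟨p.1.1, p.1.2, hz, this⟩
  · rintro ⟨a, b, hz, hab⟩
    have hne : a ≠ b := by rintro rfl; exact (pairEqn_self_pos a z).ne' hz
    have : (⟨(a, b), hne⟩ : BoundaryPair) ∈ (Quotient.mk' : BoundaryPair → HypGeodesic) ⁻¹' C := by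
      rw [← hKC]; exact hab
    exact ⟨_, this, hz⟩

/-- The geodesics meeting a compact set form a compact set. -/
lemma isCompact_meeting {B : Set ℍ} (hB : IsCompact B) :
    IsCompact {γ : HypGeodesic | (γ.carrier ∩ B).Nonempty} := by
  have h1 : IsCompact (Prod.fst '' ({q : (OnePoint ℝ × OnePoint ℝ) × ℍ |
      pairEqn q.1.1 q.1.2 q.2 = 0} ∩ univ ×ˢ B)) :=
    ((isCompact_univ.prod hB).inter_left isClosed_pairEqn_eq_zero).image continuous_fst
  have h2 : IsCompact {p : BoundaryPair | ∃ z ∈ B, pairEqn p.1.1 p.1.2 z = 0} := by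
    rw [Topology.IsEmbedding.subtypeVal.isCompact_iff]
    convert h1 using 1
    ext ⟨a, b⟩
    constructor
    · rintro ⟨p, ⟨z, hz, hp⟩, hpe⟩
      rw [← hpe]
      exact ⟨(p.1, z), ⟨hp, mem_univ _, hz⟩, rfl⟩
    · rintro ⟨⟨q, z⟩, ⟨hq, -, hz⟩, hqe⟩
      obtain rfl : q = (a, b) := hqe
      have hq : pairEqn a b z = 0 := hq
      have hne : a ≠ b := by rintro rfl; exact (pairEqn_self_pos a z).ne' hq
      exact ⟨⟨(a, b), hne⟩, ⟨z, hz, hq⟩, rfl⟩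
  convert h2.image (continuous_quotient_mk' (s := BoundaryPair.setoid)) using 1
  ext γ
  constructor
  · rintro ⟨z, hz, hzB⟩
    induction γ using Quotient.inductionOn with | _ p
    exact ⟨p, ⟨z, hzB, hz⟩, rfl⟩
  · rintro ⟨p, ⟨z, hzB, hz⟩, rfl⟩
    exact ⟨z, hz, hzB⟩

end HypGeodesic

/-! ### The support of a current with `0`-hyperbolic dual space -/

namespace HypGeodesic

/-- The hypothesis says that `xw` and `yz` are the diagonals of a parallelogram. A violation would
place `{x, w}` and `{y, z}` on opposite sides of `γ`, one pair strictly, although the two diagonals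
share their midpoint. -/
lemma sepDist_add_le_of_midpoint {γ : HypGeodesic} {x y z w : ℍ}
    (h : γ.eqn x + γ.eqn w = γ.eqn y + γ.eqn z) :
    γ.sepDist x y + γ.sepDist z w ≤ γ.sepDist y z + γ.sepDist x w := by
  by_contra! h'
  rw [add_comm, sepDist_comm γ z w] at h'
  simp only [sepDist_eq_sign] at h'
  obtain ⟨e, ⟨h1, h2, h3, h4⟩ | ⟨h1, h2, h3, h4⟩⟩ := split_of_sign_lt h'
  · have := congrArg (e * ·) h
    simp only [mul_add] at this
    linarith
  · have := congrArg (e * ·) h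
    simp only [mul_add] at this
    linarith

lemma sepDist_eq_one {γ : HypGeodesic} {x y : ℍ} (h : γ.eqn x * γ.eqn y < 0) :
    γ.sepDist x y = 1 := by
  rw [sepDist_eq_sign]
  rcases mul_neg_iff.1 h with ⟨h1, h2⟩ | ⟨h1, h2⟩ <;> simp [h1, h2] <;> norm_num

lemma sepDist_eq_zero {γ : HypGeodesic} {x y : ℍ} (h : 0 < γ.eqn x * γ.eqn y) :
    γ.sepDist x y = 0 := by
  rw [sepDist_eq_sign]
  rcases mul_pos_iff.1 h with ⟨h1, h2⟩ | ⟨h1, h2⟩ <;> simp [h1, h2]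

/-- If the linear parts were proportional, the common point would make the constant terms
proportional too, and the geodesics would coincide. -/
lemma coeff_det_ne_zero {γ γ' : HypGeodesic} (hne : γ ≠ γ') {p : ℍ} (hp : p ∈ γ.carrier)
    (hp' : p ∈ γ'.carrier) :
    γ.coeff.1 * γ'.coeff.2.1 - γ'.coeff.1 * γ.coeff.2.1 ≠ 0 := by
  have hp : γ.eqn p = 0 := hp
  have hp' : γ'.eqn p = 0 := hp'
  rw [eqn_eq_coeff] at hp hp'
  intro h
  rcases coeff_cases γ with ⟨x, y, -, -, h1⟩ | ⟨x, -, h1⟩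
  · rw [h1] at hp h
    refine hne (eq_of_coeff_eq_smul (c := γ'.coeff.1) ?_)
    rw [h1]
    simp only at h hp
    ext <;> simp
    · linarith
    · have : γ'.coeff.2.1 = -γ'.coeff.1 * (x + y) := by linarith
      rw [this] at hp'
      linear_combination hp' - γ'.coeff.1 * hp
  · rw [h1] at hp h
    refine hne (eq_of_coeff_eq_smul (c := -γ'.coeff.2.1) ?_)
    rw [h1]
    simp only at h hp
    have h0 : γ'.coeff.1 = 0 := by linarith
    ext <;> simp
    · exact h0
    · rw [h0] at hp'
      linear_combination hp' + γ'.coeff.2.1 * hp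

/-- Around a crossing point of two geodesics there are points in all four sectors, on two lines
through the crossing point and at equal distance from it in the affine coordinates. -/
lemma exists_four_points {γ γ' : HypGeodesic} (hne : γ ≠ γ')
    (hd : ¬ Disjoint γ.carrier γ'.carrier) : ∃ x y z w : ℍ,
      (∀ β : HypGeodesic, β.eqn x + β.eqn w = β.eqn y + β.eqn z) ∧
      (γ.eqn x < 0 ∧ γ.eqn y < 0 ∧ 0 < γ.eqn z ∧ 0 < γ.eqn w) ∧
      (γ'.eqn x < 0 ∧ γ'.eqn z < 0 ∧ 0 < γ'.eqn y ∧ 0 < γ'.eqn w) := by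
  obtain ⟨p, hp, hp'⟩ := not_disjoint_iff.1 hd
  have hΔ := coeff_det_ne_zero hne hp hp'
  have hp : γ.eqn p = 0 := hp
  have hp' : γ'.eqn p = 0 := hp'
  set Δ := γ.coeff.1 * γ'.coeff.2.1 - γ'.coeff.1 * γ.coeff.2.1 with hΔe
  -- Cramer's rule: the displacement along which the linear parts of `γ` and `γ'` take the
  -- prescribed values `s` and `t`.
  let dv : ℝ → ℝ → ℝ := fun s t => (s * γ'.coeff.2.1 - t * γ.coeff.2.1) / Δ
  let du : ℝ → ℝ → ℝ := fun s t => (t * γ.coeff.1 - s * γ'.coeff.1) / Δ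
  have hγ : ∀ s t, γ.coeff.1 * dv s t + γ.coeff.2.1 * du s t = s := by
    intro s t
    simp only [dv, du]
    field_simp
    rw [hΔe]; ring
  have hγ' : ∀ s t, γ'.coeff.1 * dv s t + γ'.coeff.2.1 * du s t = t := by
    intro s t
    simp only [dv, du]
    field_simp
    rw [hΔe]; ring
  -- Small displacements stay above the parabola, because `p` lies strictly above it.
  have hev : ∀ s t, ∀ᶠ ε in nhds (0 : ℝ), (p.re + ε * du s t) ^ 2 < p.absSq + ε * dv s t := by
    intro s t
    have h1 : Continuous fun ε : ℝ => (p.re + ε * du s t) ^ 2 := by fun_prop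
    have h2 : Continuous fun ε : ℝ => p.absSq + ε * dv s t := by fun_prop
    refine h1.continuousAt.eventually_lt h2.continuousAt ?_
    simpa using p.re_sq_lt_absSq
  have hall := (((hev (-1) (-1)).and (hev (-1) 1)).and ((hev 1 (-1)).and (hev 1 1)))
  obtain ⟨ε, ⟨⟨h1, h2⟩, h3, h4⟩, hε⟩ :=
    ((hall.filter_mono nhdsWithin_le_nhds).and (self_mem_nhdsWithin (s := Ioi (0 : ℝ)))).exists
  have hε : 0 < ε := hε
  obtain ⟨x, hx, hx'⟩ := UpperHalfPlane.exists_re_eq_absSq_eq h1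
  obtain ⟨y, hy, hy'⟩ := UpperHalfPlane.exists_re_eq_absSq_eq h2
  obtain ⟨z, hz, hz'⟩ := UpperHalfPlane.exists_re_eq_absSq_eq h3
  obtain ⟨w, hw, hw'⟩ := UpperHalfPlane.exists_re_eq_absSq_eq h4
  have hval : ∀ (β : HypGeodesic) (q : ℍ) (s t : ℝ), q.re = p.re + ε * du s t →
      q.absSq = p.absSq + ε * dv s t →
      β.eqn q = β.eqn p + ε * (β.coeff.1 * dv s t + β.coeff.2.1 * du s t) := by
    intro β q s t h1 h2
    rw [eqn_eq_coeff, eqn_eq_coeff, h1, h2]; ring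
  refine ⟨x, y, z, w, fun β => ?_, ?_, ?_⟩
  · rw [hval β x _ _ hx hx', hval β y _ _ hy hy', hval β z _ _ hz hz', hval β w _ _ hw hw']
    simp only [dv, du]
    ring
  · rw [hval γ x _ _ hx hx', hval γ y _ _ hy hy', hval γ z _ _ hz hz', hval γ w _ _ hw hw', hγ, hγ,
      hγ, hγ, hp]
    refine ⟨?_, ?_, ?_, ?_⟩ <;> linarith
  · rw [hval γ' x _ _ hx hx', hval γ' y _ _ hy hy', hval γ' z _ _ hz hz', hval γ' w _ _ hw hw',
      hγ', hγ', hγ', hγ', hp']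
    refine ⟨?_, ?_, ?_, ?_⟩ <;> linarith

end HypGeodesic

namespace GeodesicCurrent

variable {Γ : Subgroup SL(2, ℝ)} (μ : GeodesicCurrent Γ)

lemma measure_pos_of_mem_support {γ : HypGeodesic} (hγ : γ ∈ μ.toMeasure.support)
    {U : Set HypGeodesic} (hU : IsOpen U) (h : γ ∈ U) : 0 < μ.toMeasure U :=
  (Measure.mem_support_iff_forall γ).1 hγ U (hU.mem_nhds h)

/-- The difference of the integrands is nonnegative everywhere and equals `2` on an open
neighbourhood of `γ`, which has positive mass since `γ` is in the support. -/
lemma pdist_add_lt {x y z w : ℍ}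
    (h : ∀ β : HypGeodesic, β.eqn x + β.eqn w = β.eqn y + β.eqn z) {γ : HypGeodesic}
    (hγ : γ ∈ μ.toMeasure.support) (hx : γ.eqn x < 0) (hy : γ.eqn y < 0) (hz : 0 < γ.eqn z)
    (hw : 0 < γ.eqn w) :
    μ.pdist x y + μ.pdist z w < μ.pdist y z + μ.pdist x w := by
  rw [pdist_add_eq_integral, pdist_add_eq_integral]
  have h1 := (μ.integrable_sepDist x y).add (μ.integrable_sepDist z w)
  have h2 := (μ.integrable_sepDist y z).add (μ.integrable_sepDist x w)
  rw [← sub_pos]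
  refine lt_of_lt_of_eq ?_ (integral_sub h2 h1)
  rw [integral_pos_iff_support_of_nonneg (fun β => sub_nonneg.2
    (HypGeodesic.sepDist_add_le_of_midpoint (h β))) (h2.sub h1)]
  have hU : IsOpen ({β : HypGeodesic | β.eqn y * β.eqn z < 0} ∩ {β | β.eqn x * β.eqn w < 0}
      ∩ {β | β.eqn x * β.eqn z < 0}) :=
    ((HypGeodesic.isOpen_eqn_mul_neg y z).inter (HypGeodesic.isOpen_eqn_mul_neg x w)).inter
      (HypGeodesic.isOpen_eqn_mul_neg x z)
  refine (μ.measure_pos_of_mem_support hγ hU ⟨⟨mul_neg_of_neg_of_pos hy hz,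
    mul_neg_of_neg_of_pos hx hw⟩, mul_neg_of_neg_of_pos hx hz⟩).trans_le (measure_mono ?_)
  rintro β ⟨⟨h3, h4⟩, h5⟩
  have h3 : β.eqn y * β.eqn z < 0 := h3
  have h4 : β.eqn x * β.eqn w < 0 := h4
  have h5 : β.eqn x * β.eqn z < 0 := h5
  have h6 : 0 < β.eqn x * β.eqn y := by
    rcases mul_neg_iff.1 h5 with ⟨h, h'⟩ | ⟨h, h'⟩
    · exact mul_pos h (pos_of_mul_neg_left h3 h'.le)
    · exact mul_pos_of_neg_of_neg h (neg_of_mul_neg_left h3 h'.le)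
  have h7 : 0 < β.eqn z * β.eqn w := by
    rcases mul_neg_iff.1 h5 with ⟨h, h'⟩ | ⟨h, h'⟩
    · exact mul_pos_of_neg_of_neg h' (neg_of_mul_neg_right h4 h.le)
    · exact mul_pos h' (pos_of_mul_neg_right h4 h.le)
  simp [Function.mem_support, HypGeodesic.sepDist_eq_one h3, HypGeodesic.sepDist_eq_one h4,
    HypGeodesic.sepDist_eq_zero h6, HypGeodesic.sepDist_eq_zero h7]

/-- Around a crossing, the same parallelogram serves both geodesics: `γ` makes the diagonals beat
one pair of sides, `γ'` the other pair. -/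
lemma disjoint_of_mem_support (h : IsDeltaHyperbolic 0 (DualSpace μ)) {γ γ' : HypGeodesic}
    (hγ : γ ∈ μ.toMeasure.support) (hγ' : γ' ∈ μ.toMeasure.support) (hne : γ ≠ γ') :
    Disjoint γ.carrier γ'.carrier := by
  by_contra hd
  obtain ⟨x, y, z, w, hmid, ⟨h1, h2, h3, h4⟩, h5, h6, h7, h8⟩ :=
    HypGeodesic.exists_four_points hne hd
  have h9 := μ.pdist_add_lt hmid hγ h1 h2 h3 h4
  have h10 := μ.pdist_add_lt (fun β => (hmid β).trans (add_comm _ _)) hγ' h5 h6 h7 h8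
  have h11 := μ.isDeltaHyperbolic_zero_iff.1 h y z x w
  rw [μ.pdist_comm y x, μ.pdist_comm z x] at h11
  rw [μ.pdist_comm z y] at h10
  exact absurd h11 (not_le.2 (max_lt h9 h10))

/-- The support of a current, as a geodesic lamination. -/
def supportLamination (h : IsDeltaHyperbolic 0 (DualSpace μ)) : GeodesicLamination Γ where
  leaves := μ.toMeasure.support
  invariant g hg γ hγ := by
    rw [Measure.mem_support_iff_forall]
    intro V hV
    obtain ⟨U, hUV, hU, hγU⟩ := mem_nhds_iff.1 hV
    refine lt_of_lt_of_le ?_ (measure_mono hUV)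
    rw [← μ.invariant g hg U hU.measurableSet]
    exact μ.measure_pos_of_mem_support hγ (hU.preimage (HypGeodesic.continuous_act g)) hγU
  disjoint _ hγ _ hγ' hne := μ.disjoint_of_mem_support h hγ hγ' hne
  closed := HypGeodesic.isClosed_biUnion_carrier Measure.isClosed_support

end GeodesicCurrent

/-! ### Leaves through points and crossings of transverse arcs -/

instance : Nonempty HypGeodesic :=
  ⟨Quotient.mk _ ⟨((0 : ℝ), OnePoint.infty), OnePoint.coe_ne_infty 0⟩⟩

lemma HypGeodesic.continuous_eqn (γ : HypGeodesic) : Continuous γ.eqn := by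
  have hre := UpperHalfPlane.continuous_re
  have habs := UpperHalfPlane.continuous_absSq
  have : γ.eqn = fun z => γ.coeff.1 * z.absSq + γ.coeff.2.1 * z.re + γ.coeff.2.2 :=
    funext γ.eqn_eq_coeff
  rw [this]
  fun_prop

lemma HypGeodesic.isClosed_carrier (γ : HypGeodesic) : IsClosed γ.carrier :=
  isClosed_eq γ.continuous_eqn continuous_const

namespace GeodesicLamination

variable {Γ : Subgroup SL(2, ℝ)} (Λ : GeodesicLamination Γ)

/-- The leaf through a point of the lamination. -/
def leafAt (z : ℍ) : HypGeodesic := Classical.epsilon fun γ => γ ∈ Λ.leaves ∧ z ∈ γ.carrier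

lemma mem_union {z : ℍ} : z ∈ Λ.union ↔ ∃ γ ∈ Λ.leaves, z ∈ γ.carrier := by
  simp [union]

variable {Λ} in
lemma eq_of_mem {γ γ' : HypGeodesic} (hγ : γ ∈ Λ.leaves) (hγ' : γ' ∈ Λ.leaves) {z : ℍ}
    (hz : z ∈ γ.carrier) (hz' : z ∈ γ'.carrier) : γ = γ' := by
  by_contra hne
  exact disjoint_left.1 (Λ.disjoint γ hγ γ' hγ' hne) hz hz'

variable {Λ} in
lemma leafAt_eq {γ : HypGeodesic} (hγ : γ ∈ Λ.leaves) {z : ℍ} (hz : z ∈ γ.carrier) :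
    Λ.leafAt z = γ := by
  have h : Λ.leafAt z ∈ Λ.leaves ∧ z ∈ (Λ.leafAt z).carrier :=
    Classical.epsilon_spec (p := fun γ => γ ∈ Λ.leaves ∧ z ∈ γ.carrier) ⟨γ, hγ, hz⟩
  exact eq_of_mem h.1 hγ h.2 hz

variable {Λ} in
-- The points whose leaf lies in a closed set `C` form the trace on the lamination of the union of
-- the geodesics in `C ∩ Λ`, and unions of closed sets of geodesics are closed.
lemma continuousOn_leafAt (hΛ : IsClosed Λ.leaves) : ContinuousOn Λ.leafAt Λ.union := by
  rw [continuousOn_iff_isClosed]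
  intro C hC
  refine ⟨_, HypGeodesic.isClosed_biUnion_carrier (hC.inter hΛ), ?_⟩
  ext z
  simp only [mem_inter_iff, mem_preimage, mem_iUnion, exists_prop]
  refine and_congr_left fun hz => ?_
  obtain ⟨γ, hγ, hzγ⟩ := Λ.mem_union.1 hz
  rw [leafAt_eq hγ hzγ]
  constructor
  · exact fun h => ⟨γ, ⟨h, hγ⟩, hzγ⟩
  · rintro ⟨γ', ⟨h, hγ'⟩, hz'⟩
    rwa [eq_of_mem hγ hγ' hzγ hz']

variable {Λ} in
/-- The set of leaves meeting a Borel set that meets every leaf at most once is Borel. -/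
lemma measurableSet_leaves_meeting (hΛ : IsClosed Λ.leaves) {B : Set ℍ} (hB : MeasurableSet B)
    (hinj : ∀ γ ∈ Λ.leaves, (γ.carrier ∩ B).Subsingleton) :
    MeasurableSet {γ ∈ Λ.leaves | (γ.carrier ∩ B).Nonempty} := by
  have hU : MeasurableSet (B ∩ Λ.union) := hB.inter Λ.closed.measurableSet
  -- Lusin–Souslin: an injective continuous image of a Borel set is Borel.
  convert hU.image_of_continuousOn_injOn
    ((continuousOn_leafAt hΛ).mono inter_subset_right) ?_ using 1
  · ext γ
    constructor
    · rintro ⟨hγ, z, hz, hzB⟩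
      exact ⟨z, ⟨hzB, Λ.mem_union.2 ⟨γ, hγ, hz⟩⟩, leafAt_eq hγ hz⟩
    · rintro ⟨z, ⟨hzB, hz⟩, rfl⟩
      obtain ⟨γ, hγ, hzγ⟩ := Λ.mem_union.1 hz
      rw [leafAt_eq hγ hzγ]
      exact ⟨hγ, z, hzγ, hzB⟩
  · rintro z ⟨hzB, hz⟩ w ⟨hwB, hw⟩ h
    obtain ⟨γ, hγ, hzγ⟩ := Λ.mem_union.1 hz
    obtain ⟨γ', hγ', hwγ'⟩ := Λ.mem_union.1 hw
    rw [leafAt_eq hγ hzγ, leafAt_eq hγ' hwγ'] at h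
    subst h
    exact hinj γ hγ ⟨hzγ, hzB⟩ ⟨hwγ', hwB⟩

/-! ### Cutting a transverse arc into pieces that meet each leaf at most once -/

namespace TransverseArc

variable {Λ} (α : Λ.TransverseArc)

lemma continuousOn_path : ContinuousOn α.path I :=
  UpperHalfPlane.isEmbedding_coe.continuousOn_iff.2 α.contDiff.continuousOn

lemma contDiffOn_re : ContDiffOn ℝ 1 (fun t => (α.path t).re) I :=
  Complex.reCLM.contDiff.comp_contDiffOn α.contDiff

lemma contDiffOn_absSq : ContDiffOn ℝ 1 (fun t => (α.path t).absSq) I :=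
  (α.contDiffOn_re.pow 2).add
    ((Complex.imCLM.contDiff.comp_contDiffOn α.contDiff : ContDiffOn ℝ 1
      (fun t => (α.path t).im) I).pow 2)

/-- The derivative of an arc in the coordinates `(|z|², Re z)`. -/
def velocity (t : ℝ) : ℝ × ℝ × ℝ :=
  (derivWithin (fun t => (α.path t).absSq) I t, derivWithin (fun t => (α.path t).re) I t, 0)

lemma continuousOn_velocity : ContinuousOn α.velocity I :=
  (α.contDiffOn_absSq.continuousOn_derivWithin uniqueDiffOn_Icc_zero_one le_rfl).prodMk
    ((α.contDiffOn_re.continuousOn_derivWithin uniqueDiffOn_Icc_zero_one le_rfl).prodMk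
      continuousOn_const)

lemma hasDerivWithinAt_eqn (γ : HypGeodesic) {t : ℝ} (ht : t ∈ I) :
    HasDerivWithinAt (fun s => γ.eqn (α.path s)) (coeffForm (α.velocity t) γ.coeff) I t := by
  have h1 := (α.contDiffOn_absSq.differentiableOn one_ne_zero t ht).hasDerivWithinAt
  have h2 := (α.contDiffOn_re.differentiableOn one_ne_zero t ht).hasDerivWithinAt
  refine (((h1.const_mul γ.coeff.1).add (h2.const_mul γ.coeff.2.1)).add_const
    γ.coeff.2.2).congr_deriv ?_ |>.congr_of_eventuallyEq ?_ ?_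
  · simp only [coeffForm, velocity]; ring
  · exact Filter.Eventually.of_forall fun s => γ.eqn_eq_coeff _
  · exact γ.eqn_eq_coeff _

lemma derivWithin_eqn (γ : HypGeodesic) {t : ℝ} (ht : t ∈ I) :
    derivWithin (fun s => γ.eqn (α.path s)) I t = coeffForm (α.velocity t) γ.coeff :=
  (α.hasDerivWithinAt_eqn γ ht).derivWithin (uniqueDiffOn_Icc_zero_one t ht)

/-- Locally, a transverse arc meets every leaf at most once. -/
lemma eventually_eq_of_mem_leaf (hΛ : IsClosed Λ.leaves) {t₀ : ℝ} (ht₀ : t₀ ∈ I) :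
    ∃ ε > 0, ∀ γ ∈ Λ.leaves, ∀ s ∈ I, ∀ t ∈ I, |s - t₀| < ε → |t - t₀| < ε →
      α.path s ∈ γ.carrier → α.path t ∈ γ.carrier → s = t := by
  by_cases hU : α.path t₀ ∈ Λ.union
  · obtain ⟨γ₀, hγ₀, hmem⟩ := Λ.mem_union.1 hU
    -- Transversality at `γ₀` is an open condition in the velocity and the leaf together, so it
    -- persists for nearby parameters and nearby leaves.
    have hO : {q : (ℝ × ℝ × ℝ) × HypGeodesic | coeffForm q.1 q.2.coeff ≠ 0}
        ∈ nhds (α.velocity t₀) ×ˢ nhds γ₀ := by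
      rw [← nhds_prod_eq]
      refine HypGeodesic.isOpen_coeffForm_ne.mem_nhds ?_
      show coeffForm _ _ ≠ 0
      rw [← α.derivWithin_eqn γ₀ ht₀]
      exact α.transverse t₀ ht₀ γ₀ hγ₀ hmem
    obtain ⟨A, hA, U, hU', hAU⟩ := Filter.mem_prod_iff.1 hO
    have h1 : ∀ᶠ t in nhdsWithin t₀ I, α.velocity t ∈ A := α.continuousOn_velocity t₀ ht₀ hA
    have h2 : ∀ᶠ t in nhdsWithin t₀ I, α.path t ∈ Λ.union → Λ.leafAt (α.path t) ∈ U := by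
      have h := continuousOn_leafAt hΛ _ hU
      have hU'' : U ∈ nhds (Λ.leafAt (α.path t₀)) := by rwa [leafAt_eq hγ₀ hmem]
      have h3 := eventually_nhdsWithin_iff.1 (h hU'')
      exact (α.continuousOn_path t₀ ht₀).eventually h3
    obtain ⟨ε, hε, hball⟩ := Metric.mem_nhdsWithin_iff.1 (h1.and h2)
    have key : ∀ γ ∈ Λ.leaves, ∀ s ∈ I, ∀ t ∈ I, |s - t₀| < ε → |t - t₀| < ε →
        α.path s ∈ γ.carrier → α.path t ∈ γ.carrier → ¬ s < t := by
      intro γ hγ s hs t ht hsε htε hsγ htγ hst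
      have hsub : Icc s t ⊆ I := fun r hr => ⟨hs.1.trans hr.1, hr.2.trans ht.2⟩
      -- Rolle: two crossings with one leaf would give a tangency in between, to a leaf close to
      -- `γ₀`.
      obtain ⟨r, hr, hr0⟩ := exists_deriv_eq_zero (f := fun r => γ.eqn (α.path r)) hst
        (γ.continuous_eqn.comp_continuousOn (α.continuousOn_path.mono hsub))
        ((hsγ : γ.eqn _ = 0).trans (htγ : γ.eqn _ = 0).symm)
      have hrI := hsub (Ioo_subset_Icc_self hr)
      have hγU : γ ∈ U := by
        have := (hball ⟨hsε, hs⟩).2 (Λ.mem_union.2 ⟨γ, hγ, hsγ⟩)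
        rwa [leafAt_eq hγ hsγ] at this
      have hrε : |r - t₀| < ε := by
        rw [abs_lt] at *
        constructor <;> linarith [hr.1, hr.2]
      refine hAU (mk_mem_prod (hball ⟨hrε, hrI⟩).1 hγU) ?_
      show coeffForm (α.velocity r) γ.coeff = 0
      rw [← α.derivWithin_eqn γ hrI, derivWithin_of_mem_nhds, hr0]
      exact Icc_mem_nhds (hs.1.trans_lt hr.1) (hr.2.trans_le ht.2)
    refine ⟨ε, hε, fun γ hγ s hs t ht hsε htε hsγ htγ => ?_⟩
    rcases lt_trichotomy s t with h | h | h
    · exact absurd h (key γ hγ s hs t ht hsε htε hsγ htγ)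
    · exact h
    · exact absurd h (key γ hγ t ht s hs htε hsε htγ hsγ)
  · have : ∀ᶠ t in nhdsWithin t₀ I, α.path t ∈ Λ.unionᶜ :=
      α.continuousOn_path t₀ ht₀ (Λ.closed.isOpen_compl.mem_nhds hU)
    obtain ⟨ε, hε, hball⟩ := Metric.mem_nhdsWithin_iff.1 this
    exact ⟨ε, hε, fun γ hγ s hs t ht hsε htε hsγ htγ =>
      absurd (Λ.mem_union.2 ⟨γ, hγ, hsγ⟩) (hball ⟨hsε, hs⟩)⟩

/-- Uniformly, short pieces of a transverse arc meet every leaf at most once. -/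
lemma exists_pos_eq_of_mem_leaf (hΛ : IsClosed Λ.leaves) :
    ∃ δ > 0, ∀ γ ∈ Λ.leaves, ∀ s ∈ I, ∀ t ∈ I, |s - t| < δ →
      α.path s ∈ γ.carrier → α.path t ∈ γ.carrier → s = t := by
  choose ε hε h using fun t₀ : I => α.eventually_eq_of_mem_leaf hΛ t₀.2
  -- A Lebesgue number of the cover by the local intervals is a uniform length.
  obtain ⟨δ, hδ, hball⟩ := lebesgue_number_lemma_of_metric (s := I) isCompact_Icc
    (c := fun t₀ : I => Metric.ball (t₀ : ℝ) (ε t₀)) (fun _ => Metric.isOpen_ball)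
    (fun t ht => mem_iUnion.2 ⟨⟨t, ht⟩, Metric.mem_ball_self (hε _)⟩)
  refine ⟨δ, hδ, fun γ hγ s hs t ht hst hsγ htγ => ?_⟩
  obtain ⟨t₀, ht₀⟩ := hball s hs
  exact h t₀ γ hγ s hs t ht (ht₀ (Metric.mem_ball_self hδ))
    (ht₀ (by rw [Metric.mem_ball, Real.dist_eq, abs_sub_comm]; exact hst)) hsγ htγ

lemma isCompact_image : IsCompact α.image := isCompact_Icc.image_of_continuousOn α.continuousOn_path

lemma measurableSet_path_image {T : Set ℝ} (hT : T ⊆ I) (hTm : MeasurableSet T) :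
    MeasurableSet (α.path '' T) :=
  hTm.image_of_continuousOn_injOn (α.continuousOn_path.mono hT) (α.injOn.mono hT)

/-- A transverse arc is a finite union of disjoint Borel pieces meeting every leaf at most once. -/
lemma exists_partition (hΛ : IsClosed Λ.leaves) : ∃ (n : ℕ) (P : ℕ → Set ℍ),
    (∀ k, MeasurableSet (P k)) ∧ Pairwise (Function.onFun Disjoint P) ∧
    α.image = ⋃ k ∈ Finset.range n, P k ∧
    ∀ k, ∀ γ ∈ Λ.leaves, (γ.carrier ∩ P k).Subsingleton := by
  obtain ⟨δ, hδ, h⟩ := α.exists_pos_eq_of_mem_leaf hΛ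
  obtain ⟨N, hN⟩ := exists_nat_gt (1 / δ)
  have hN0 : (0 : ℝ) < N := lt_trans (by positivity) hN
  let T : ℕ → Set ℝ := fun k => {t ∈ I | ⌊t * N⌋₊ = k}
  have hTI : ∀ k, T k ⊆ I := fun k t ht => ht.1
  -- Parameters with equal `⌊t * N⌋₊` differ by less than `1 / N < δ`. The endpoint `t = 1` has
  -- floor `N`, hence `N + 1` pieces.
  refine ⟨N + 1, fun k => α.path '' T k, fun k => α.measurableSet_path_image (hTI k) ?_, ?_, ?_, ?_⟩
  · refine measurableSet_Icc.inter ?_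
    exact (Nat.measurable_floor.comp (measurable_id.mul_const (N : ℝ))) (measurableSet_singleton k)
  · intro j k hjk
    refine disjoint_left.2 ?_
    rintro z ⟨s, hs, rfl⟩ ⟨t, ht, hst⟩
    have := α.injOn ht.1 hs.1 hst
    subst this
    exact hjk (hs.2.symm.trans ht.2)
  · ext z
    simp only [mem_iUnion, Finset.mem_range, exists_prop]
    constructor
    · rintro ⟨t, ht, rfl⟩
      refine ⟨⌊t * N⌋₊, ?_, t, ⟨ht, rfl⟩, rfl⟩
      rw [Nat.floor_lt (mul_nonneg ht.1 hN0.le)]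
      push_cast
      have := mul_le_mul_of_nonneg_right ht.2 hN0.le
      linarith
    · rintro ⟨k, -, t, ht, rfl⟩
      exact ⟨t, ht.1, rfl⟩
  · rintro k γ hγ z ⟨hz, s, ⟨hs, hsk⟩, rfl⟩ w ⟨hw, t, ⟨ht, htk⟩, rfl⟩
    rw [h γ hγ s hs t ht ?_ hz hw]
    have h1 := Nat.floor_le (mul_nonneg hs.1 hN0.le)
    have h2 := Nat.lt_floor_add_one (s * N)
    have h3 := Nat.floor_le (mul_nonneg ht.1 hN0.le)
    have h4 := Nat.lt_floor_add_one (t * N)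
    rw [hsk] at h1 h2
    rw [htk] at h3 h4
    have h5 : |s - t| * N < 1 := by
      rw [← abs_of_pos hN0, ← abs_mul, sub_mul, abs_lt]
      constructor <;> linarith
    rw [div_lt_iff₀ hδ] at hN
    by_contra! h6
    have := mul_le_mul_of_nonneg_right h6 hN0.le
    linarith

end TransverseArc

end GeodesicLamination

/-! ### The transverse measure of a current -/

namespace GeodesicLamination

variable {Γ : Subgroup SL(2, ℝ)} {Λ : GeodesicLamination Γ}

namespace TransverseArc

variable (α : Λ.TransverseArc)

open Classical in
/-- The counting measure on the crossings of an arc with a leaf. -/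
def crossings (γ : HypGeodesic) : Measure ℍ :=
  if γ ∈ Λ.leaves then Measure.count.restrict (γ.carrier ∩ α.image) else 0

lemma crossings_apply_of_mem {γ : HypGeodesic} (hγ : γ ∈ Λ.leaves) {S : Set ℍ}
    (hS : MeasurableSet S) :
    α.crossings γ S = (γ.carrier ∩ α.image ∩ S).encard := by
  have hm : MeasurableSet (γ.carrier ∩ α.image) :=
    γ.isClosed_carrier.measurableSet.inter α.isCompact_image.measurableSet
  rw [crossings, if_pos hγ, Measure.restrict_apply hS, Measure.count_apply (hS.inter hm), inter_comm]

lemma crossings_of_notMem {γ : HypGeodesic} (hγ : γ ∉ Λ.leaves) : α.crossings γ = 0 := if_neg hγ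

lemma crossings_apply_of_subsingleton {P : Set ℍ} (hP : MeasurableSet P) (hPα : P ⊆ α.image)
    (hinj : ∀ γ ∈ Λ.leaves, (γ.carrier ∩ P).Subsingleton) (γ : HypGeodesic) :
    α.crossings γ P = {γ ∈ Λ.leaves | (γ.carrier ∩ P).Nonempty}.indicator 1 γ := by
  by_cases hγ : γ ∈ Λ.leaves
  · rw [α.crossings_apply_of_mem hγ hP, inter_assoc, inter_eq_self_of_subset_right hPα]
    rcases (hinj γ hγ).eq_empty_or_singleton with h | ⟨z, h⟩
    · have : γ ∉ {γ ∈ Λ.leaves | (γ.carrier ∩ P).Nonempty} := fun h' => h'.2.ne_empty h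
      rw [h, indicator_of_notMem this]
      simp
    · have : γ ∈ {γ ∈ Λ.leaves | (γ.carrier ∩ P).Nonempty} := ⟨hγ, h ▸ singleton_nonempty z⟩
      rw [h, indicator_of_mem this]
      simp
  · rw [α.crossings_of_notMem hγ, indicator_of_notMem (fun h => hγ h.1)]
    rfl

/-- On each piece of the partition the number of crossings is `0` or `1`. The finite sum yields
measurability in `γ`, and the inclusion into the geodesics meeting the arc yields finiteness after
integration. -/
lemma exists_crossings_eq_sum (hΛ : IsClosed Λ.leaves) {S : Set ℍ} (hS : MeasurableSet S) :
    ∃ (n : ℕ) (A : ℕ → Set HypGeodesic), (∀ k, MeasurableSet (A k)) ∧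
      (∀ k, A k ⊆ {γ | (γ.carrier ∩ α.image).Nonempty}) ∧
      ∀ γ, α.crossings γ S = ∑ k ∈ Finset.range n, (A k).indicator 1 γ := by
  obtain ⟨n, P, hP, hdisj, hunion, hinj⟩ := α.exists_partition hΛ
  have hPS : ∀ k, MeasurableSet (P k ∩ α.image ∩ S) := fun k =>
    ((hP k).inter α.isCompact_image.measurableSet).inter hS
  have hinj' : ∀ k, ∀ γ ∈ Λ.leaves, (γ.carrier ∩ (P k ∩ α.image ∩ S)).Subsingleton :=
    fun k γ hγ => (hinj k γ hγ).anti (inter_subset_inter_right _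
      (inter_subset_left.trans inter_subset_left))
  refine ⟨n, fun k => {γ ∈ Λ.leaves | (γ.carrier ∩ (P k ∩ α.image ∩ S)).Nonempty},
    fun k => measurableSet_leaves_meeting hΛ (hPS k) (hinj' k), ?_, ?_⟩
  · rintro k γ ⟨-, z, hz, hzP⟩
    exact ⟨z, hz, hzP.1.2⟩
  · intro γ
    have h1 : α.crossings γ S = α.crossings γ (⋃ k ∈ Finset.range n, P k ∩ α.image ∩ S) := by
      by_cases hγ : γ ∈ Λ.leaves
      · rw [α.crossings_apply_of_mem hγ hS, α.crossings_apply_of_mem hγ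
          (Finset.measurableSet_biUnion _ fun k _ => hPS k)]
        congr 2
        rw [← iUnion₂_inter, ← iUnion₂_inter, ← hunion, inter_self, inter_assoc, inter_assoc,
          ← inter_assoc α.image α.image, inter_self]
      · rw [α.crossings_of_notMem hγ]; rfl
    rw [h1, measure_biUnion_finset (fun i _ j _ hij => (hdisj hij).mono
      (inter_subset_left.trans inter_subset_left) (inter_subset_left.trans inter_subset_left))
      fun k _ => hPS k]
    refine Finset.sum_congr rfl fun k _ => ?_
    exact α.crossings_apply_of_subsingleton (hPS k)
      (inter_subset_left.trans inter_subset_right) (hinj' k) γ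

lemma measurable_crossings_apply (hΛ : IsClosed Λ.leaves) {S : Set ℍ} (hS : MeasurableSet S) :
    Measurable fun γ => α.crossings γ S := by
  obtain ⟨n, A, hA, -, h⟩ := α.exists_crossings_eq_sum hΛ hS
  simp_rw [h]
  exact Finset.measurable_fun_sum _ fun k _ => measurable_one.indicator (hA k)

lemma measurable_crossings (hΛ : IsClosed Λ.leaves) : Measurable α.crossings :=
  Measure.measurable_of_measurable_coe _ fun _ => α.measurable_crossings_apply hΛ

/-- A transverse arc crosses, near an intersection with a leaf, all nearby geodesics. -/
lemma exists_eqn_mul_neg {γ : HypGeodesic} (hγ : γ ∈ Λ.leaves) {t₀ : ℝ} (ht₀ : t₀ ∈ I)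
    (hmem : α.path t₀ ∈ γ.carrier) {V : Set ℍ} (hV : V ∈ nhds (α.path t₀)) :
    ∃ s t : ℝ, s ≤ t ∧ Icc s t ⊆ I ∧ α.path '' Icc s t ⊆ V ∧
      γ.eqn (α.path s) * γ.eqn (α.path t) < 0 := by
  have hU : α.path t₀ ∈ Λ.union := Λ.mem_union.2 ⟨γ, hγ, hmem⟩
  -- The endpoints of the arc are off the lamination, so the crossing is interior and the derivative
  -- is two-sided.
  have h0 : 0 < t₀ := lt_of_le_of_ne ht₀.1 (by rintro rfl; exact α.source_notMem hU)
  have h1 : t₀ < 1 := lt_of_le_of_ne ht₀.2 (by rintro rfl; exact α.target_notMem hU)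
  have hI : I ∈ nhds t₀ := Icc_mem_nhds h0 h1
  have hd : HasDerivAt (fun s => γ.eqn (α.path s)) (coeffForm (α.velocity t₀) γ.coeff) t₀ :=
    (α.hasDerivWithinAt_eqn γ ht₀).hasDerivAt hI
  have hne : coeffForm (α.velocity t₀) γ.coeff ≠ 0 := by
    rw [← α.derivWithin_eqn γ ht₀]
    exact α.transverse t₀ ht₀ γ hγ hmem
  set d := coeffForm (α.velocity t₀) γ.coeff
  have hslope := hasDerivAt_iff_tendsto_slope.1 hd
  -- The difference quotient has the sign of `d` on both sides of `t₀`, so the equation changes sign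
  -- there.
  have hpos : ∀ᶠ t in nhdsWithin t₀ {t₀}ᶜ,
      0 < d * slope (fun s => γ.eqn (α.path s)) t₀ t := by
    have := hslope.const_mul d
    exact this.eventually (lt_mem_nhds (mul_self_pos.2 hne))
  have hV' : ∀ᶠ t in nhds t₀, α.path t ∈ V :=
    (α.continuousOn_path.continuousAt hI) hV
  obtain ⟨ε, hε, hball⟩ := Metric.eventually_nhds_iff.1
    ((eventually_nhdsWithin_iff.1 hpos).and (hV'.and hI))
  have hsub : ∀ r ∈ Icc (t₀ - ε / 2) (t₀ + ε / 2), dist r t₀ < ε := by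
    intro r hr
    rw [Real.dist_eq, abs_lt]
    constructor <;> linarith [hr.1, hr.2]
  have hs := (hball (hsub (t₀ - ε / 2) ⟨le_rfl, by linarith⟩)).1 (by simp; positivity)
  have ht := (hball (hsub (t₀ + ε / 2) ⟨by linarith, le_rfl⟩)).1 (by simp; positivity)
  have hz : γ.eqn (α.path t₀) = 0 := hmem
  rw [slope_def_field, hz, sub_zero] at hs ht
  refine ⟨t₀ - ε / 2, t₀ + ε / 2, by linarith, fun r hr => (hball (hsub r hr)).2.2, ?_, ?_⟩
  · rintro _ ⟨r, hr, rfl⟩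
    exact (hball (hsub r hr)).2.1
  · generalize γ.eqn (α.path (t₀ - ε / 2)) = a, γ.eqn (α.path (t₀ + ε / 2)) = b at *
    have e1 : t₀ - ε / 2 - t₀ = -(ε / 2) := by ring
    have e2 : t₀ + ε / 2 - t₀ = ε / 2 := by ring
    rw [e1, div_neg, mul_neg, ← mul_div_assoc, Left.neg_pos_iff] at hs
    rw [e2, ← mul_div_assoc] at ht
    have hε2 : 0 < ε / 2 := by positivity
    have hs' : d * a < 0 := by
      by_contra! h
      exact absurd hs (not_lt.2 (div_nonneg h hε2.le))
    have ht' : 0 < d * b := by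
      by_contra! h
      exact absurd ht (not_lt.2 (div_nonpos_of_nonpos_of_nonneg h hε2.le))
    have h3 := mul_neg_of_neg_of_pos hs' ht'
    have h4 : d * a * (d * b) = d ^ 2 * (a * b) := by ring
    rw [h4] at h3
    exact neg_of_mul_neg_right h3 (sq_nonneg d)

lemma exists_mem_carrier_of_mul_neg {γ : HypGeodesic} {s t : ℝ} (hst : s ≤ t)
    (hI : Icc s t ⊆ I) (h : γ.eqn (α.path s) * γ.eqn (α.path t) < 0) :
    ∃ r ∈ Icc s t, α.path r ∈ γ.carrier := by
  have hc : ContinuousOn (fun r => γ.eqn (α.path r)) (Icc s t) :=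
    γ.continuous_eqn.comp_continuousOn (α.continuousOn_path.mono hI)
  rcases mul_neg_iff.1 h with ⟨h1, h2⟩ | ⟨h1, h2⟩
  · exact intermediate_value_Icc' hst hc ⟨h2.le, h1.le⟩
  · exact intermediate_value_Icc hst hc ⟨h1.le, h2.le⟩

lemma encard_path_image (γ : HypGeodesic) {T : Set ℝ} (hT : T ⊆ I) :
    (γ.carrier ∩ α.image ∩ α.path '' T).encard = {t ∈ T | α.path t ∈ γ.carrier}.encard := by
  rw [← (α.injOn.mono ((sep_subset T _).trans hT)).encard_image]
  congr 1
  ext z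
  constructor
  · rintro ⟨⟨hz, -⟩, t, ht, rfl⟩
    exact ⟨t, ⟨ht, hz⟩, rfl⟩
  · rintro ⟨t, ⟨ht, hz⟩, rfl⟩
    exact ⟨⟨hz, t, hT ht, rfl⟩, t, ht, rfl⟩

end TransverseArc

end GeodesicLamination

namespace GeodesicCurrent

variable {Γ : Subgroup SL(2, ℝ)} (μ : GeodesicCurrent Γ) {Λ : GeodesicLamination Γ}

/-- The measure on an arc that counts the crossings with the leaves. -/
def arcMeasure (α : Λ.TransverseArc) : Measure ℍ := μ.toMeasure.bind α.crossings

lemma arcMeasure_apply (hΛ : IsClosed Λ.leaves) (α : Λ.TransverseArc) {S : Set ℍ}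
    (hS : MeasurableSet S) : μ.arcMeasure α S = ∫⁻ γ, α.crossings γ S ∂μ.toMeasure :=
  Measure.bind_apply hS (α.measurable_crossings hΛ).aemeasurable

/-- Each of the finitely many indicators is supported in the compact set of geodesics meeting the
arc, which has finite mass. -/
lemma isFiniteMeasure_arcMeasure (hΛ : IsClosed Λ.leaves) (α : Λ.TransverseArc) :
    IsFiniteMeasure (μ.arcMeasure α) := by
  constructor
  rw [μ.arcMeasure_apply hΛ α MeasurableSet.univ]
  obtain ⟨n, A, hA, hsub, h⟩ := α.exists_crossings_eq_sum hΛ MeasurableSet.univ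
  simp_rw [h]
  rw [lintegral_finsetSum _ fun k _ => measurable_one.indicator (hA k)]
  refine ENNReal.sum_lt_top.2 fun k _ => ?_
  rw [lintegral_indicator_one (hA k)]
  have := μ.locallyFinite
  exact (measure_mono (hsub k)).trans_lt
    (HypGeodesic.isCompact_meeting α.isCompact_image).measure_lt_top

/-- All crossings lie on `α ∩ Λ`, which is closed. Conversely, near any of its points a short piece
of the arc has endpoints separated by the leaf there. The geodesics separating them form an open set
of positive mass, and almost all of these are leaves crossing that piece. -/
lemma support_arcMeasure (hΛ : Λ.leaves = μ.toMeasure.support) (α : Λ.TransverseArc) :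
    (μ.arcMeasure α).support = α.image ∩ Λ.union := by
  have hcl : IsClosed Λ.leaves := hΛ ▸ Measure.isClosed_support
  apply Subset.antisymm
  · have hcl' : IsClosed (α.image ∩ Λ.union) := α.isCompact_image.isClosed.inter Λ.closed
    refine Measure.support_subset_of_isClosed hcl' ?_
    rw [mem_ae_iff, μ.arcMeasure_apply hcl α hcl'.measurableSet.compl, 
      lintegral_eq_zero_iff (α.measurable_crossings_apply hcl hcl'.measurableSet.compl)]
    refine Filter.Eventually.of_forall fun γ => ?_
    show α.crossings γ (α.image ∩ Λ.union)ᶜ = 0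
    by_cases hγ : γ ∈ Λ.leaves
    · rw [α.crossings_apply_of_mem hγ hcl'.measurableSet.compl]
      have : γ.carrier ∩ α.image ∩ (α.image ∩ Λ.union)ᶜ = ∅ := by
        rw [← sdiff_eq, sdiff_eq_empty]
        exact fun z hz => ⟨hz.2, Λ.mem_union.2 ⟨γ, hγ, hz.1⟩⟩
      simp [this]
    · rw [α.crossings_of_notMem hγ]; rfl
  · rintro z ⟨⟨t₀, ht₀, rfl⟩, hz⟩
    obtain ⟨γ₀, hγ₀, hmem⟩ := Λ.mem_union.1 hz
    rw [Measure.mem_support_iff_forall]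
    intro V hV
    obtain ⟨W, hWV, hW, hW₀⟩ := mem_nhds_iff.1 hV
    refine lt_of_lt_of_le ?_ (measure_mono hWV)
    obtain ⟨s, t, hst, hI, himg, hneg⟩ := α.exists_eqn_mul_neg hγ₀ ht₀ hmem (hW.mem_nhds hW₀)
    have hU := HypGeodesic.isOpen_eqn_mul_neg (α.path s) (α.path t)
    refine (μ.measure_pos_of_mem_support (hΛ ▸ hγ₀) hU hneg).trans_le ?_
    rw [μ.arcMeasure_apply hcl α hW.measurableSet, ← lintegral_indicator_one hU.measurableSet]
    refine lintegral_mono_ae ?_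
    have hae : ∀ᵐ γ ∂μ.toMeasure, γ ∈ Λ.leaves := hΛ ▸ Measure.support_mem_ae
    filter_upwards [hae] with γ hγ
    by_cases hγU : γ ∈ {γ : HypGeodesic | γ.eqn (α.path s) * γ.eqn (α.path t) < 0}
    · obtain ⟨r, hr, hrγ⟩ := α.exists_mem_carrier_of_mul_neg hst hI hγU
      rw [indicator_of_mem hγU, Pi.one_apply, α.crossings_apply_of_mem hγ hW.measurableSet]
      have : (γ.carrier ∩ α.image ∩ W).Nonempty :=
        ⟨α.path r, ⟨hrγ, r, hI hr, rfl⟩, himg ⟨r, hr, rfl⟩⟩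
      exact_mod_cast one_le_encard_iff_nonempty.2 this
    · rw [indicator_of_notMem hγU]
      exact bot_le

/-- The transverse measure induced by a current on its support. -/
def transverseMeasure (hΛ : Λ.leaves = μ.toMeasure.support) : Λ.TransverseMeasure where
  measure := μ.arcMeasure
  locallyFinite α := by
    have := μ.isFiniteMeasure_arcMeasure (hΛ ▸ Measure.isClosed_support) α
    infer_instance
  support_eq := μ.support_arcMeasure hΛ
  restrict_eq α β hβα := by
    have hcl : IsClosed Λ.leaves := hΛ ▸ Measure.isClosed_support
    have hβ := β.isCompact_image.measurableSet
    ext S hS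
    rw [Measure.restrict_apply hS, μ.arcMeasure_apply hcl β hS,
      μ.arcMeasure_apply hcl α (hS.inter hβ)]
    refine lintegral_congr fun γ => ?_
    by_cases hγ : γ ∈ Λ.leaves
    · rw [α.crossings_apply_of_mem hγ (hS.inter hβ), β.crossings_apply_of_mem hγ hS]
      congr 2
      ext z
      simp only [mem_inter_iff]
      have := @hβα z
      tauto
    · rw [α.crossings_of_notMem hγ, β.crossings_of_notMem hγ]; rfl
  isotopy_eq A hA T hT hTm := by
    have hcl : IsClosed Λ.leaves := hΛ ▸ Measure.isClosed_support
    have h0 := (A 0).measurableSet_path_image hT hTm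
    have h1 := (A 1).measurableSet_path_image hT hTm
    rw [μ.arcMeasure_apply hcl _ h1, μ.arcMeasure_apply hcl _ h0]
    refine lintegral_congr fun γ => ?_
    by_cases hγ : γ ∈ Λ.leaves
    · rw [(A 1).crossings_apply_of_mem hγ h1, (A 0).crossings_apply_of_mem hγ h0,
        (A 1).encard_path_image γ hT, (A 0).encard_path_image γ hT]
      congr 2
      ext t
      -- An isotopy keeps the set of parameters at which the arc meets a given leaf, so crossings
      -- are counted by the same parameters.
      exact and_congr_right fun ht => hA.2 1 ⟨zero_le_one, le_rfl⟩ t (hT ht) γ hγ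
    · rw [(A 1).crossings_of_notMem hγ, (A 0).crossings_of_notMem hγ]; rfl
  equivariant g hg α β hαβ S hS := by
    have hcl : IsClosed Λ.leaves := hΛ ▸ Measure.isClosed_support
    have hmeas : Measurable (HypGeodesic.act g) := (HypGeodesic.continuous_act g).measurable
    have hmap : μ.toMeasure.map (HypGeodesic.act g) = μ.toMeasure := by
      ext A hA
      rw [Measure.map_apply hmeas hA, μ.invariant g hg A hA]
    have hgc : Continuous fun z : ℍ => g • z := continuous_const_smul (g : GL (Fin 2) ℝ)
    have hgS : MeasurableSet ((fun z : ℍ => g • z) ⁻¹' S) := hgc.measurable hS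
    rw [μ.arcMeasure_apply hcl α hgS, μ.arcMeasure_apply hcl β hS]
    -- Substituting `g γ` for `γ` by invariance of `μ` reduces the claim to the bijection `z ↦ g •
    -- z` between the crossings of `γ` with `α` and of `g γ` with `β`.
    conv_rhs => rw [← hmap]
    rw [lintegral_map (β.measurable_crossings_apply hcl hS) hmeas]
    refine lintegral_congr_ae ?_
    have hae : ∀ᵐ γ ∂μ.toMeasure, γ ∈ Λ.leaves := hΛ ▸ Measure.support_mem_ae
    filter_upwards [hae] with γ hγ
    rw [α.crossings_apply_of_mem hγ hgS, β.crossings_apply_of_mem (Λ.invariant g hg γ hγ) hS,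
      ← (MulAction.injective g).encard_image]
    congr 2
    ext z
    constructor
    · rintro ⟨w, ⟨⟨hw, t, ht, rfl⟩, hwS⟩, rfl⟩
      exact ⟨⟨(HypGeodesic.smul_mem_carrier_act g γ _).2 hw, t, ht, hαβ t ht⟩, hwS⟩
    · rintro ⟨⟨hz, t, ht, rfl⟩, hzS⟩
      rw [hαβ t ht] at hz hzS ⊢
      exact ⟨_, ⟨⟨(HypGeodesic.smul_mem_carrier_act g γ _).1 hz, t, ht, rfl⟩, hzS⟩, rfl⟩

/-- For an arc meeting each leaf at most once, the crossing count is the indicator of the leaves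
that cross it, so integrating gives the mass of those leaves. The complement of the support is null.
-/
lemma isCurrentOf_transverseMeasure (hΛ : Λ.leaves = μ.toMeasure.support) :
    μ.IsCurrentOf Λ (μ.transverseMeasure hΛ) := by
  have hcl : IsClosed Λ.leaves := hΛ ▸ Measure.isClosed_support
  refine ⟨hΛ ▸ Measure.measure_compl_support, fun α hα S hS => ?_⟩
  have hm := α.isCompact_image.measurableSet.inter hS
  have hinj : ∀ γ ∈ Λ.leaves, (γ.carrier ∩ (α.image ∩ S)).Subsingleton := fun γ hγ =>
    (hα γ hγ).anti (inter_subset_inter_right _ inter_subset_left)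
  have hA := GeodesicLamination.measurableSet_leaves_meeting hcl hm hinj
  simp only [inter_assoc]
  rw [← lintegral_indicator_one hA]
  refine (μ.arcMeasure_apply hcl α hS).trans (lintegral_congr fun γ => ?_)
  rw [← α.crossings_apply_of_subsingleton hm inter_subset_left hinj γ]
  by_cases hγ : γ ∈ Λ.leaves
  · rw [α.crossings_apply_of_mem hγ hS, α.crossings_apply_of_mem hγ hm, ← inter_assoc,
      inter_assoc γ.carrier α.image α.image, inter_self]
  · rw [α.crossings_of_notMem hγ]; rfl

lemma isMeasuredLamination_of_isDeltaHyperbolic (h : IsDeltaHyperbolic 0 (DualSpace μ)) :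
    μ.IsMeasuredLamination :=
  ⟨μ.supportLamination h, μ.transverseMeasure rfl, μ.isCurrentOf_transverseMeasure rfl⟩

end GeodesicCurrent

end

theorem mainTheorem2 (Γ : Subgroup SL(2, ℝ)) (hΓ : IsClosedSurfaceGroup Γ)
    (μ : GeodesicCurrent Γ) :
    IsDeltaHyperbolic 0 (DualSpace μ) ↔ μ.IsMeasuredLamination :=
  ⟨μ.isMeasuredLamination_of_isDeltaHyperbolic, fun h => h.isDeltaHyperbolic⟩
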